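/- Let $\mathcal O_n$ be the local ring of germs at $0$ of holomorphic functions $(\mathbb C^n,0)\to\mathbb C$, and let $\Theta_n$ be the $\mathcal O_n$-module of germs at $0$ of holomorphic vector fields on $\mathbb C^n$. For $h\in\mathcal O_n$ and $\xi=\sum_i\xi_i\,\partial/\partial x_i\in\Theta_n$ write $dh(\xi)=\sum_i\xi_i\,\partial h/\partial x_i$, write $Jh\subseteq\mathcal O_n$ for the ideal generated by the partial derivatives of $h$, and for a submodule $M\subseteq\Theta_n$ write $dh(M)=\{dh(\xi):\xi\in M\}$. For a set germ $(X,0)$ in $\mathbb C^n$ let $I_X\subseteq\mathcal O_n$ be the ideal of germs vanishing on $(X,0)$, and put $$\Theta_X=\{\xi\in\Theta_n : dh(\xi)\in I_X \text{ for all } h\in I_X\},\qquad df(\Theta_X^-)=df(\Theta_X)+I_X,\qquad \mu_{BR}^-(f,X)=\dim_{\mathbb C}\frac{\mathcal O_n}{df(\Theta_X)+I_X}.$$ **Theorem.** Let $(X,0)\subset(\mathbb C^n,0)$ be an isolated hypersurface singularity determined by $\phi:(\mathbb C^n,0)\to(\mathbb C,0)$; that is, $\phi\neq0$, $(X,0)$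 is the zero set of $\phi$, the ideal $I_X$ is generated by $\phi$, and every point $x\ne0$ of $X$ close to $0$ satisfies $\partial\phi/\partial x_i(x)\neq0$ for some $i$. Let $\Theta_X^T\subseteq\Theta_X$ be the $\mathcal O_n$-submodule generated by the vector fields $\phi\,\frac{\partial}{\partial x_i}$ and $\frac{\partial\phi}{\partial x_j}\frac{\partial}{\partial x_k}-\frac{\partial\phi}{\partial x_k}\frac{\partial}{\partial x_j}$ with $i,j,k=1,\dots,n$ and $k\ne j$. Let $f\in\mathcal O_n$ be such that $\mu_{BR}^-(f,X)<\infty$. Then, where $\cong$ denotes isomorphism of $\mathcal O_n$-modules and $A:B=\{a\in\mathcal O_n : aB\subseteq A\}$ is the colon ideal, 1. $\displaystyle \frac{\Theta_X}{\Theta_X^T}\cong\frac{df(\Theta_X)+I_X}{df(\Theta_X^T)+I_X}$; 2. $\displaystyle \frac{\Theta_X}{\Theta_X^T}\cong\frac{df(\Theta_X)}{df(\Theta_X^T)}$; 3. $df(\Theta_X)\cap I_X=Jf\cdot I_X$; 4. $\displaystyle \frac{\mathcal O_n}{Jf}\cong\frac{df(\Theta_X^-)}{df(\Theta_X)}$;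 5. $df(\Theta_X):I_X=Jf$; 6. $df(\Theta_X^T):I_X=Jf$. -/

import Mathlib

open Filter Topology

noncomputable section

namespace BruceRoberts

/-- The ring `𝒪ₙ` of germs at `0` of holomorphic functions `(ℂⁿ, 0) → ℂ`, as a subring of the ring
of all germs at `0` of functions `ℂⁿ → ℂ`. -/
def holSubring (n : ℕ) : Subring (Germ (𝓝 (0 : Fin n → ℂ)) ℂ) where
  carrier := {g | ∃ F : (Fin n → ℂ) → ℂ, AnalyticAt ℂ F 0 ∧ (F : Germ (𝓝 (0 : Fin n → ℂ)) ℂ) = g}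
  zero_mem' := ⟨fun _ => 0, analyticAt_const, rfl⟩
  one_mem' := ⟨fun _ => 1, analyticAt_const, rfl⟩
  add_mem' := by
    rintro _ _ ⟨F, hF, rfl⟩ ⟨G, hG, rfl⟩
    exact ⟨F + G, hF.add hG, rfl⟩
  mul_mem' := by
    rintro _ _ ⟨F, hF, rfl⟩ ⟨G, hG, rfl⟩
    exact ⟨F * G, hF.mul hG, rfl⟩
  neg_mem' := by
    rintro _ ⟨F, hF, rfl⟩
    exact ⟨-F, hF.neg, rfl⟩

/-- The local ring `𝒪ₙ` of holomorphic function germs at the origin of `ℂⁿ`. -/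
abbrev HolGerm (n : ℕ) : Type := holSubring n

variable {n : ℕ}

/-- The germ at `0` of a function that is holomorphic near `0`. -/
def HolGerm.of (F : (Fin n → ℂ) → ℂ) (hF : AnalyticAt ℂ F 0) : HolGerm n :=
  ⟨(F : Germ (𝓝 (0 : Fin n → ℂ)) ℂ), F, hF, rfl⟩

/-- `𝒪ₙ` is a `ℂ`-algebra through the constant functions. -/
instance (n : ℕ) : Algebra ℂ (HolGerm n) :=
  RingHom.toAlgebra
    { toFun := fun c => HolGerm.of (fun _ => c) analyticAt_const
      map_one' := rfl
      map_zero' := rfl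
      map_add' := fun _ _ => rfl
      map_mul' := fun _ _ => rfl }

/-- A chosen function representing a germ. Near `0` it does not depend on the choice. -/
def rep (g : HolGerm n) : (Fin n → ℂ) → ℂ := g.2.choose

lemma analyticAt_rep (g : HolGerm n) : AnalyticAt ℂ (rep g) 0 := g.2.choose_spec.1

lemma of_rep (g : HolGerm n) : HolGerm.of (rep g) (analyticAt_rep g) = g :=
  Subtype.ext g.2.choose_spec.2

lemma rep_of (F : (Fin n → ℂ) → ℂ) (hF : AnalyticAt ℂ F 0) : rep (HolGerm.of F hF) =ᶠ[𝓝 0] F :=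
  Germ.coe_eq.1 (HolGerm.of F hF).2.choose_spec.2

lemma of_eq_of {F G : (Fin n → ℂ) → ℂ} (hF : AnalyticAt ℂ F 0) (hG : AnalyticAt ℂ G 0)
    (h : F =ᶠ[𝓝 0] G) : HolGerm.of F hF = HolGerm.of G hG :=
  Subtype.ext (Germ.coe_eq.2 h)

lemma rep_add (g h : HolGerm n) : rep (g + h) =ᶠ[𝓝 0] rep g + rep h := by
  conv_lhs => rw [← of_rep g, ← of_rep h]
  exact rep_of _ ((analyticAt_rep g).add (analyticAt_rep h))

lemma rep_mul (g h : HolGerm n) : rep (g * h) =ᶠ[𝓝 0] rep g * rep h := by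
  conv_lhs => rw [← of_rep g, ← of_rep h]
  exact rep_of _ ((analyticAt_rep g).mul (analyticAt_rep h))

lemma rep_zero : rep (0 : HolGerm n) =ᶠ[𝓝 0] 0 :=
  rep_of (fun _ => 0) analyticAt_const

lemma analyticAt_partial {F : (Fin n → ℂ) → ℂ} (hF : AnalyticAt ℂ F 0) (i : Fin n) :
    AnalyticAt ℂ (fun x => fderiv ℂ F x (Pi.single i 1)) 0 :=
  ((ContinuousLinearMap.apply ℂ ℂ (Pi.single i (1 : ℂ) : Fin n → ℂ)).analyticAt _).comp hF.fderiv

/-- The partial derivative `∂g/∂xᵢ` of a germ `g ∈ 𝒪ₙ`. -/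
def pd (i : Fin n) (g : HolGerm n) : HolGerm n :=
  HolGerm.of (fun x => fderiv ℂ (rep g) x (Pi.single i 1)) (analyticAt_partial (analyticAt_rep g) i)

lemma pd_of (i : Fin n) (F : (Fin n → ℂ) → ℂ) (hF : AnalyticAt ℂ F 0) :
    pd i (HolGerm.of F hF) =
      HolGerm.of (fun x => fderiv ℂ F x (Pi.single i 1)) (analyticAt_partial hF i) :=
  of_eq_of _ _ (((rep_of F hF).fderiv (𝕜 := ℂ)).mono fun x hx => by simp only [hx])

lemma pd_mul (i : Fin n) (g h : HolGerm n) : pd i (g * h) = g * pd i h + h * pd i g := by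
  have e : g * h = HolGerm.of (rep g * rep h) ((analyticAt_rep g).mul (analyticAt_rep h)) := by
    conv_lhs => rw [← of_rep g, ← of_rep h]
    rfl
  have e' : g * pd i h + h * pd i g = HolGerm.of
      (rep g * (fun x => fderiv ℂ (rep h) x (Pi.single i 1)) +
        rep h * (fun x => fderiv ℂ (rep g) x (Pi.single i 1)))
      (((analyticAt_rep g).mul (analyticAt_partial (analyticAt_rep h) i)).add
        ((analyticAt_rep h).mul (analyticAt_partial (analyticAt_rep g) i))) := by
    conv_lhs => enter [1, 1]; rw [← of_rep g]
    conv_lhs => enter [2, 1]; rw [← of_rep h]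
    rfl
  rw [e, pd_of, e']
  refine of_eq_of _ _ ?_
  filter_upwards [(analyticAt_rep g).eventually_analyticAt,
    (analyticAt_rep h).eventually_analyticAt] with x hg hh
  rw [fderiv_mul hg.differentiableAt hh.differentiableAt]
  simp

/-- The module `Θₙ` of germs at `0` of holomorphic vector fields on `ℂⁿ`; the tuple `ξ` stands for
the vector field `∑ i, ξ i • ∂/∂xᵢ`. -/
abbrev VectorField (n : ℕ) : Type := Fin n → HolGerm n

/-- The differential `dh : Θₙ → 𝒪ₙ`, `dh(ξ) = ∑ i, ξ i * ∂h/∂xᵢ`. -/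
def diff (h : HolGerm n) : VectorField n →ₗ[HolGerm n] HolGerm n :=
  Fintype.linearCombination (HolGerm n) (fun i => pd i h)

lemma diff_apply (h : HolGerm n) (ξ : VectorField n) : diff h ξ = ∑ i, ξ i * pd i h := by
  simp [diff, Fintype.linearCombination_apply]

/-- The ideal `df(M) ⊆ 𝒪ₙ`, for a submodule `M` of `Θₙ`. -/
def diffImage (f : HolGerm n) (M : Submodule (HolGerm n) (VectorField n)) : Ideal (HolGerm n) :=
  M.map (diff f)

/-- The Jacobian ideal `Jf`, generated by the partial derivatives of `f`. -/
def jacobianIdeal (f : HolGerm n) : Ideal (HolGerm n) :=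
  Ideal.span (Set.range fun i => pd i f)

/-- The ideal `I_X` of the germs in `𝒪ₙ` that vanish on the set germ `(X, 0)`. -/
def vanishingIdeal (X : Set (Fin n → ℂ)) : Ideal (HolGerm n) where
  carrier := {h | ∀ᶠ x in 𝓝 0, x ∈ X → rep h x = 0}
  zero_mem' := rep_zero.mono fun x hx _ => hx
  add_mem' := by
    intro g h hg hh
    filter_upwards [hg, hh, rep_add g h] with x h1 h2 h3 hx
    simp [h3, h1 hx, h2 hx]
  smul_mem' := by
    intro c h hh
    filter_upwards [hh, rep_mul c h] with x h1 h2 hx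
    simp [smul_eq_mul, h2, h1 hx]

/-- The module `Θ_X` of the vector fields `ξ` such that `dh(ξ) ∈ I_X` for all `h ∈ I_X`. -/
def logVectorFields (X : Set (Fin n → ℂ)) : Submodule (HolGerm n) (VectorField n) where
  carrier := {ξ | ∀ h ∈ vanishingIdeal X, diff h ξ ∈ vanishingIdeal X}
  zero_mem' := fun h _ => by simp
  add_mem' := fun ha hb h hh => by
    rw [map_add]
    exact add_mem (ha h hh) (hb h hh)
  smul_mem' := fun c ξ hξ h hh => by
    rw [map_smul]
    exact Submodule.smul_mem _ c (hξ h hh)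

/-- The module `Θ_X^T` of the trivial vector fields, generated by the `φ ∂/∂xᵢ` and the
`∂φ/∂xⱼ ∂/∂xₖ - ∂φ/∂xₖ ∂/∂xⱼ` with `k ≠ j`. -/
def trivialVectorFields (φ : HolGerm n) : Submodule (HolGerm n) (VectorField n) :=
  Submodule.span (HolGerm n)
    ({ξ | ∃ i : Fin n, ξ = Pi.single i φ} ∪
      {ξ | ∃ j k : Fin n, k ≠ j ∧ ξ = Pi.single k (pd j φ) - Pi.single j (pd k φ)})

/-- The ideal `df(Θ_X^-) = df(Θ_X) + I_X`. -/
def relDiffImage (f : HolGerm n) (X : Set (Fin n → ℂ)) : Ideal (HolGerm n) :=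
  diffImage f (logVectorFields X) ⊔ vanishingIdeal X

/-- The relative Bruce-Roberts number `μ_BR^-(f, X) = dim_ℂ 𝒪ₙ / (df(Θ_X) + I_X)`. -/
def relBruceRobertsNumber (f : HolGerm n) (X : Set (Fin n → ℂ)) : ℕ∞ :=
  Cardinal.toENat (Module.rank ℂ (HolGerm n ⧸ relDiffImage f X))

/-- `(X, 0)` is the isolated hypersurface singularity determined by `φ : (ℂⁿ, 0) → (ℂ, 0)`: it is
the zero set of `φ ≠ 0`, it has no singular point other than `0` near `0`, and `φ` is an equation of
`(X, 0)` in the sense that it generates `I_X`, that is, `φ` is reduced. -/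
structure IsIHS (φ : HolGerm n) (X : Set (Fin n → ℂ)) : Prop where
  ne_zero : φ ≠ 0
  map_zero : rep φ 0 = 0
  zeroSet : ∀ᶠ x in 𝓝 (0 : Fin n → ℂ), x ∈ X ↔ rep φ x = 0
  vanishingIdeal_eq : vanishingIdeal X = Ideal.span {φ}
  isolated : ∀ᶠ x in 𝓝 (0 : Fin n → ℂ), x ∈ X → x ≠ 0 → ∃ i, rep (pd i φ) x ≠ 0

/-- `Θ_X^T ⊆ Θ_X`, so that the quotient `Θ_X / Θ_X^T` makes sense. -/
lemma trivialVectorFields_le {φ : HolGerm n} {X : Set (Fin n → ℂ)} (h : IsIHS φ X) :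
    trivialVectorFields φ ≤ logVectorFields X := by
  have hφ : φ ∈ vanishingIdeal X := by
    rw [h.vanishingIdeal_eq]; exact Ideal.mem_span_singleton_self φ
  refine Submodule.span_le.2 ?_
  rintro ξ (⟨i, rfl⟩ | ⟨j, k, -, rfl⟩) g hg
  · have : diff g (Pi.single i φ) = φ * pd i g := by
      simp [diff, Fintype.linearCombination_apply_single]
    rw [this]
    exact Ideal.mul_mem_right _ _ hφ
  · rw [h.vanishingIdeal_eq, Ideal.mem_span_singleton'] at hg
    obtain ⟨a, rfl⟩ := hg
    have : diff (a * φ) (Pi.single k (pd j φ) - Pi.single j (pd k φ)) =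
        φ * (pd j φ * pd k a - pd k φ * pd j a) := by
      simp only [map_sub, diff, Fintype.linearCombination_apply_single, pd_mul, smul_eq_mul]
      ring
    rw [this]
    exact Ideal.mul_mem_right _ _ hφ

end BruceRoberts

end

open BruceRoberts

/-!
Write `𝒪` for the ring of germs and `𝔪` for its maximal ideal. By `mem_logVectorFields_iff` a vector
field `ξ` is in `Θ_X` if and only if `dφ(ξ) ∈ (φ)`. All six claims are formal consequences
(`isomorphisms_and_colon_eq`) of one property of `φ` and `f`, and of `φ` being a nonzerodivisor:

if `dφ(ξ) ∈ (φ)` and `df(ξ) ∈ (φ)`, then `ξ = τ + φη` with `τ ∈ Θ_X^T` and `df(τ) = 0`.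

For `n ≥ 2` this is a statement on the Buchsbaum-Rim complex of the map `(dφ, df) : Rⁿ → R²` over
`R = 𝒪/(φ)`. The image of `⋀³ Rⁿ → Rⁿ` consists of the classes of fields of the form of `τ`, so the
property follows from exactness at `Rⁿ`. The complex has length `n - 1`, which is the depth of `R`,
and its homology in positive degrees is killed by the squares of the `2 × 2` minors of `(dφ, df)`,
by explicit homotopies. If the minors generate an `𝔪`-primary ideal modulo `φ`, the acyclicity lemma
of Peskine and Szpiro (`exact_of_depthGE`) gives the exactness.

To see that this ideal, which is `df(Θ_X^T) + (φ)`, contains a power of `𝔪`: every partial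
derivative of `φ` maps `Θ_X` into `Θ_X^T`, so that `(Jφ + (φ)) (df(Θ_X) + I_X) ⊆ df(Θ_X^T) + (φ)`
(`jacobianIdeal_sup_mul_relDiffImage_le`). The second factor contains a power of `𝔪` since it has
finite colength, and the first one does by the Nullstellensatz, as the singularity is isolated.

Depth is measured by the vanishing of `Ext(𝒪/𝔪, -)`, so that Noetherianity of `𝒪` is not needed. The
depth of `𝒪` is `n` since the coordinates are a regular sequence, which is read off from Taylor
expansions. The Nullstellensatz is needed for an isolated common zero only
(`germMaximalIdeal_le_radical`). It is proved by induction on `n`: Weierstrass division replaces the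
germs by polynomials in `x₀`, whose resultants are germs in the other variables with an isolated
common zero. In one variable `X = {0}` and `φ' ≠ 0` at the origin, and `n = 0` is impossible.
-/

noncomputable section

namespace BruceRoberts

/-! ### Depth through the vanishing of `Ext`, and the acyclicity lemma -/

section Depth

open CategoryTheory Abelian

universe u

variable {A : Type u} [CommRing A]

/-- `DepthGE 𝔪 k M` says that `Extⁱ(A/𝔪, M) = 0` for `i < k`. For a finitely generated module over a
Noetherian local ring this means that the depth of `M` is at least `k`; taken as a definition, it
makes sense for every module and needs no finiteness of `A`. -/
def DepthGE (𝔪 : Ideal A) (k : ℕ) (M : Type u) [AddCommGroup M] [Module A M] : Prop :=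
  ∀ i < k, Subsingleton (Ext (ModuleCat.of A (A ⧸ 𝔪)) (ModuleCat.of A M) i)

variable {𝔪 : Ideal A} {k : ℕ} {M N P : Type u} [AddCommGroup M] [Module A M]
  [AddCommGroup N] [Module A N] [AddCommGroup P] [Module A P]

lemma DepthGE.mono {l : ℕ} (h : DepthGE 𝔪 k M) (hl : l ≤ k) : DepthGE 𝔪 l M :=
  fun i hi => h i (hi.trans_le hl)

lemma DepthGE.of_linearEquiv (e : M ≃ₗ[A] N) (h : DepthGE 𝔪 k M) : DepthGE 𝔪 k N := by
  intro i hi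
  have := h i hi
  refine subsingleton_of_forall_eq 0 fun x => ?_
  have hx : (x.comp (Ext.mk₀ (ModuleCat.ofHom e.symm.toLinearMap)) (add_zero i)).comp
      (Ext.mk₀ (ModuleCat.ofHom e.toLinearMap)) (add_zero i) = x := by
    rw [Ext.comp_assoc_of_third_deg_zero, Ext.mk₀_comp_mk₀, ← ModuleCat.ofHom_comp]
    simp
  rw [← hx, Subsingleton.elim (x.comp (Ext.mk₀ (ModuleCat.ofHom e.symm.toLinearMap))
    (add_zero i)) 0, Ext.zero_comp]

lemma depthGE_of_subsingleton [Subsingleton M] : DepthGE 𝔪 k M := by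
  intro i hi
  refine subsingleton_of_forall_eq 0 fun x => ?_
  have : (Ext.mk₀ (𝟙 (ModuleCat.of A M))) = 0 := by
    rw [← Ext.mk₀_zero]
    congr 1
    ext m
    exact Subsingleton.elim (α := M) _ _
  rw [← x.comp_mk₀_id, this, Ext.comp_zero]

lemma shortExact_of_linearMap {f : M →ₗ[A] N} {g : N →ₗ[A] P} (hf : Function.Injective f)
    (hfg : Function.Exact f g) (hg : Function.Surjective g) :
    (ModuleCat.shortComplexOfCompEqZero f g hfg.linearMap_comp_eq_zero).ShortExact where
  exact := ModuleCat.shortComplex_exact _ hfg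
  mono_f := (ModuleCat.mono_iff_injective _).2 hf
  epi_g := (ModuleCat.epi_iff_surjective _).2 hg

lemma DepthGE.of_quotient {f : M →ₗ[A] N} {g : N →ₗ[A] P} (hf : Function.Injective f)
    (hfg : Function.Exact f g) (hg : Function.Surjective g)
    (hM : DepthGE 𝔪 (k + 1) M) (hN : DepthGE 𝔪 k N) : DepthGE 𝔪 k P := by
  intro i hi
  refine subsingleton_of_forall_eq 0 fun x => ?_
  have hM' := hM (i + 1) (by omega)
  have hN' := hN i hi
  obtain ⟨y, rfl⟩ := Ext.covariant_sequence_exact₃ _ (shortExact_of_linearMap hf hfg hg) x rfl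
    (hM'.elim _ _)
  rw [hN'.elim y 0, Ext.zero_comp]

lemma DepthGE.of_extension {f : M →ₗ[A] N} {g : N →ₗ[A] P} (hf : Function.Injective f)
    (hfg : Function.Exact f g) (hg : Function.Surjective g)
    (hM : DepthGE 𝔪 k M) (hP : DepthGE 𝔪 k P) : DepthGE 𝔪 k N := by
  intro i hi
  refine subsingleton_of_forall_eq 0 fun x => ?_
  have hM' := hM i hi
  have hP' := hP i hi
  obtain ⟨y, rfl⟩ := Ext.covariant_sequence_exact₂ _ (shortExact_of_linearMap hf hfg hg) x
    (hP'.elim _ _)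
  rw [hM'.elim y 0, Ext.zero_comp]

/-- A nonzerodivisor `x ∈ 𝔪` raises the depth of `M/xM` by one, because `x` kills `Ext(A/𝔪, M)`. -/
lemma DepthGE.of_regular {x : A} (hx : x ∈ 𝔪) {g : M →ₗ[A] P}
    (hf : Function.Injective (LinearMap.lsmul A M x))
    (hfg : Function.Exact (LinearMap.lsmul A M x) g) (hg : Function.Surjective g)
    (hP : DepthGE 𝔪 k P) : DepthGE 𝔪 (k + 1) M := by
  have kill (i : ℕ) (y : Ext (ModuleCat.of A (A ⧸ 𝔪)) (ModuleCat.of A M) i) :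
      y.comp (Ext.mk₀ (ModuleCat.ofHom (LinearMap.lsmul A M x))) (add_zero i) = 0 := by
    have hann : x ∈ Module.annihilator A (ModuleCat.of A (A ⧸ 𝔪)) := by
      change x ∈ Module.annihilator A (A ⧸ 𝔪)
      rwa [Ideal.annihilator_quotient]
    have h := ConcreteCategory.congr_hom
      (Ext.postcomp_smul_id_eq_zero_of_mem_annihilator (M := ModuleCat.of A M) hann i) y
    exact h
  intro i hi
  refine subsingleton_of_forall_eq 0 fun y => ?_
  cases i with
  | zero =>
    have := shortExact_of_linearMap hf hfg hg
    have := this.mono_f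
    exact Ext.postcomp_mk₀_injective_of_mono _
      (ModuleCat.ofHom (LinearMap.lsmul A M x)) (hf := this) ((kill 0 y).trans (by simp))
  | succ i =>
    have hP' := hP i (by omega)
    obtain ⟨z, rfl⟩ := Ext.covariant_sequence_exact₁ _ (shortExact_of_linearMap hf hfg hg) y
      (kill _ y) rfl
    rw [hP'.elim z 0, Ext.zero_comp]

lemma DepthGE.eq_zero_of_forall_smul_eq_zero (h : DepthGE 𝔪 1 M) {z : M}
    (hz : ∀ a ∈ 𝔪, a • z = 0) : z = 0 := by
  have := h 0 one_pos
  have h1 : Subsingleton ((A ⧸ 𝔪) →ₗ[A] M) :=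
    ((Ext.addEquiv₀ (X := ModuleCat.of A (A ⧸ 𝔪)) (Y := ModuleCat.of A M)).trans
      ModuleCat.homAddEquiv).symm.toEquiv.subsingleton
  have h2 : 𝔪 ≤ LinearMap.ker (LinearMap.toSpanSingleton A M z) := fun a ha => by
    simpa using hz a ha
  have h3 := LinearMap.congr_fun (h1.elim (Submodule.liftQ 𝔪 _ h2) 0) (Submodule.Quotient.mk 1)
  rw [Submodule.liftQ_apply] at h3
  simpa using h3

/-- A module of depth at least one has no nonzero `𝔪`-power torsion. -/
lemma DepthGE.eq_zero_of_pow (h : DepthGE 𝔪 1 M) (N : ℕ) {z : M}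
    (hz : ∀ a ∈ 𝔪 ^ N, a • z = 0) : z = 0 := by
  induction N with
  | zero => simpa using hz 1 (by simp)
  | succ N ih =>
    refine ih fun a ha => h.eq_zero_of_forall_smul_eq_zero fun b hb => ?_
    rw [smul_smul]
    exact hz _ (by rw [pow_succ']; exact Ideal.mul_mem_mul hb ha)

lemma DepthGE.pi_fin (h : DepthGE 𝔪 k M) (m : ℕ) : DepthGE 𝔪 k (Fin m → M) := by
  induction m with
  | zero => exact depthGE_of_subsingleton
  | succ m ih =>
    refine DepthGE.of_extension (M := M) (P := Fin m → M)
      (f := LinearMap.single A (fun _ : Fin (m + 1) => M) 0)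
      (g := LinearMap.funLeft A M Fin.succ) ?_ ?_ ?_ h ih
    · exact Pi.single_injective (M := fun _ : Fin (m + 1) => M) 0
    · intro y
      constructor
      · intro hy
        refine ⟨y 0, funext fun i => ?_⟩
        refine Fin.cases ?_ (fun j => ?_) i
        · simp
        · have := congrFun hy j
          simp only [LinearMap.funLeft_apply, Pi.zero_apply] at this
          simp [this]
      · rintro ⟨z, rfl⟩
        ext j
        simp [LinearMap.funLeft_apply]
    · exact LinearMap.funLeft_surjective_of_injective A M _ (Fin.succ_injective m)

/-- The acyclicity lemma of Peskine and Szpiro: a complex `0 → C_D → ⋯ → C₁ → C₀` of modules of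
depth at least `D ≥ 1` whose homology in positive degrees is `𝔪`-power torsion is exact in positive
degrees. -/
theorem exact_of_depthGE (𝔪 : Ideal A) {C : ℕ → Type u} [∀ k, AddCommGroup (C k)]
    [∀ k, Module A (C k)] (d : ∀ k, C (k + 1) →ₗ[A] C k) (hd : ∀ k z, d k (d (k + 1) z) = 0)
    {D : ℕ} (hD : 1 ≤ D) (hsub : ∀ k, D < k → Subsingleton (C k)) (hdepth : ∀ k, DepthGE 𝔪 D (C k))
    (htors : ∀ k, ∃ N, ∀ z, d k z = 0 → ∀ a ∈ 𝔪 ^ N, ∃ y, d (k + 1) y = a • z) :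
    ∀ k z, d k z = 0 → ∃ y, d (k + 1) y = z := by
  -- Exactness at `C (k + 1)`, once the boundaries there have depth at least `2`.
  have key (k : ℕ) (h : DepthGE 𝔪 2 (LinearMap.range (d (k + 1)))) :
      LinearMap.ker (d k) ≤ LinearMap.range (d (k + 1)) := by
    set B := LinearMap.range (d (k + 1)) with hB
    have hQ : DepthGE 𝔪 1 (C (k + 1) ⧸ B) := DepthGE.of_quotient
      (f := B.subtype) (g := B.mkQ) B.subtype_injective
      (by intro x; simp) B.mkQ_surjective h ((hdepth _).mono hD)
    obtain ⟨N, hN⟩ := htors k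
    intro z hz
    have : B.mkQ z = 0 := hQ.eq_zero_of_pow N fun a ha => by
      obtain ⟨y, hy⟩ := hN z hz a ha
      rw [← map_smul, ← hy]
      simp [hB]
    simpa using this
  have depthB : ∀ j k, D ≤ k + j → 1 ≤ k → DepthGE 𝔪 (k + 1) (LinearMap.range (d k)) := by
    intro j
    induction j with
    | zero =>
      intro k hk _
      have := hsub (k + 1) (by omega)
      have : Subsingleton (LinearMap.range (d k)) :=
        (LinearMap.surjective_rangeRestrict (d k)).subsingleton
      exact depthGE_of_subsingleton
    | succ j ih =>
      intro k hk h1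
      by_cases hkD : D ≤ k
      · exact ih k (by omega) h1
      have hB := ih (k + 1) (by omega) (by omega)
      have hle := key k (hB.mono (by omega))
      refine DepthGE.of_quotient (f := (LinearMap.range (d (k + 1))).subtype)
        (g := (d k).rangeRestrict) (Submodule.subtype_injective _) ?_
        (LinearMap.surjective_rangeRestrict (d k)) hB ((hdepth _).mono (by omega))
      intro x
      constructor
      · intro hx
        obtain ⟨y, hy⟩ := hle (show x ∈ LinearMap.ker (d k) by simpa [Subtype.ext_iff] using hx)
        exact ⟨⟨x, y, hy⟩, rfl⟩
      · rintro ⟨⟨_, y, rfl⟩, rfl⟩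
        simp [Subtype.ext_iff, hd]
  intro k z hz
  exact key k ((depthB D (k + 1) (by omega) (by omega)).mono (by omega)) hz

end Depth

/-! ### The Buchsbaum-Rim complex of two linear forms -/

section BuchsbaumRim

open CliffordAlgebra (contractLeft contractLeft_ι_mul contractLeft_comm contractLeft_contractLeft)

universe u

variable {R : Type u} [CommRing R] {F : Type u} [AddCommGroup F] [Module R F]

lemma contractLeft_mem_exteriorPower (p : Module.Dual R F) (i : ℕ) {x : ExteriorAlgebra R F}
    (hx : x ∈ ⋀[R]^(i + 1) F) : contractLeft p x ∈ ⋀[R]^i F := by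
  induction i generalizing x with
  | zero =>
    rw [ExteriorAlgebra.exteriorPower, zero_add, pow_one] at hx
    obtain ⟨v, rfl⟩ := hx
    rw [CliffordAlgebra.contractLeft_ι, ExteriorAlgebra.exteriorPower, pow_zero]
    exact Submodule.algebraMap_mem _
  | succ i ih =>
    rw [ExteriorAlgebra.exteriorPower, pow_succ'] at hx
    induction hx using Submodule.mul_induction_on' with
    | mem_mul_mem a ha b hb =>
      obtain ⟨v, rfl⟩ := ha
      rw [contractLeft_ι_mul]
      refine sub_mem (Submodule.smul_mem _ _ hb) ?_
      rw [ExteriorAlgebra.exteriorPower, pow_succ']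
      exact Submodule.mul_mem_mul ⟨v, rfl⟩ (ih hb)
    | add a _ b _ ha hb =>
      rw [map_add]
      exact add_mem ha hb

/-- Contraction with a linear form, on the exterior powers. -/
def contract (p : Module.Dual R F) (i : ℕ) : ⋀[R]^(i + 1) F →ₗ[R] ⋀[R]^i F :=
  (contractLeft p).restrict fun _ hx => contractLeft_mem_exteriorPower p i hx

/-- Exterior multiplication with a vector from the left, on the exterior powers. -/
def wedge (e : F) (i : ℕ) : ⋀[R]^i F →ₗ[R] ⋀[R]^(i + 1) F :=
  (LinearMap.mulLeft R (ExteriorAlgebra.ι R e)).restrict fun x hx => by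
    rw [ExteriorAlgebra.exteriorPower, pow_succ']
    exact Submodule.mul_mem_mul ⟨e, rfl⟩ hx

lemma coe_contract (p : Module.Dual R F) (i : ℕ) (x : ⋀[R]^(i + 1) F) :
    (contract p i x : ExteriorAlgebra R F) = contractLeft p (x : ExteriorAlgebra R F) := rfl

lemma contract_contract (p : Module.Dual R F) (i : ℕ) (x : ⋀[R]^(i + 2) F) :
    contract p i (contract p (i + 1) x) = 0 :=
  Subtype.ext (contractLeft_contractLeft _ _)

lemma contract_comm (p q : Module.Dual R F) (i : ℕ) (x : ⋀[R]^(i + 2) F) :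
    contract p i (contract q (i + 1) x) = -contract q i (contract p (i + 1) x) :=
  Subtype.ext (contractLeft_comm _ _ _)

lemma contract_wedge (p : Module.Dual R F) (e : F) (i : ℕ) (x : ⋀[R]^(i + 1) F) :
    contract p (i + 1) (wedge e (i + 1) x) = p e • x - wedge e i (contract p i x) :=
  Subtype.ext (contractLeft_ι_mul _ _ _)

/-- The exterior degree of the `k`-th term of the Buchsbaum-Rim complex. -/
def brDeg : ℕ → ℕ
  | 0 => 0
  | 1 => 1
  | k + 2 => k + 3

/-- The number of copies of the exterior power in the `k`-th term of the Buchsbaum-Rim complex. -/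
def brLen : ℕ → ℕ
  | 0 => 2
  | 1 => 1
  | k + 2 => k + 1

variable (R F) in
/-- The terms of the Buchsbaum-Rim complex of a map `F → R²`: they are `R²`, `F` and
`(⋀^{k+1} F)^{k-1}` for `k ≥ 2`, the exponent being the rank of the divided power `D_{k-2} R²`. -/
abbrev BRComplex (k : ℕ) : Type u := Fin (brLen k) → ⋀[R]^(brDeg k) F

variable (p q : Module.Dual R F)

/-- The map `(p, q) : F → R²`. -/
def brD₀ : (Fin 1 → ⋀[R]^1 F) →ₗ[R] (Fin 2 → ⋀[R]^0 F) :=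
  LinearMap.pi ![contract p 0 ∘ₗ LinearMap.proj 0, contract q 0 ∘ₗ LinearMap.proj 0]

/-- The double contraction `⋀³ F → F`. -/
def brD₁ : (Fin 1 → ⋀[R]^3 F) →ₗ[R] (Fin 1 → ⋀[R]^1 F) :=
  LinearMap.pi fun _ => contract p 1 ∘ₗ contract q 2 ∘ₗ LinearMap.proj 0

/-- The higher differentials: the differential of the Koszul complex of `p + t q`, in the basis of
the divided power that is dual to the monomials in `t`. -/
def brD₂ (k : ℕ) : (Fin (k + 2) → ⋀[R]^(k + 4) F) →ₗ[R] (Fin (k + 1) → ⋀[R]^(k + 3) F) :=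
  LinearMap.pi fun j => contract p (k + 3) ∘ₗ LinearMap.proj j.castSucc +
    contract q (k + 3) ∘ₗ LinearMap.proj j.succ

lemma brD₁_apply (z : Fin 1 → ⋀[R]^3 F) (j : Fin 1) :
    brD₁ p q z j = contract p 1 (contract q 2 (z 0)) := rfl

lemma brD₂_apply (k : ℕ) (z : Fin (k + 2) → ⋀[R]^(k + 4) F) (j : Fin (k + 1)) :
    brD₂ p q k z j = contract p (k + 3) (z j.castSucc) + contract q (k + 3) (z j.succ) := rfl

/-- The differential of the Buchsbaum-Rim complex of `(p, q) : F → R²`. -/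
def brD : ∀ k, BRComplex R F (k + 1) →ₗ[R] BRComplex R F k
  | 0 => brD₀ p q
  | 1 => brD₁ p q
  | k + 2 => brD₂ p q k

lemma brD₀_brD₁ (z : Fin 1 → ⋀[R]^3 F) : brD₀ p q (brD₁ p q z) = 0 := by
  funext j
  fin_cases j
  · exact contract_contract p 0 _
  · change contract q 0 (contract p 1 (contract q 2 (z 0))) = 0
    rw [contract_comm, contract_contract, map_zero, neg_zero]

lemma brD₁_brD₂ (z : Fin 2 → ⋀[R]^4 F) : brD₁ p q (brD₂ p q 0 z) = 0 := by
  funext j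
  rw [brD₁_apply, brD₂_apply, map_add, map_add, contract_contract, map_zero, add_zero,
    contract_comm q p, map_neg, contract_contract, neg_zero]
  rfl

lemma brD₂_brD₂ (k : ℕ) (z : Fin (k + 3) → ⋀[R]^(k + 5) F) :
    brD₂ p q k (brD₂ p q (k + 1) z) = 0 := by
  funext j
  rw [brD₂_apply, brD₂_apply, brD₂_apply, map_add, map_add,
    contract_contract, contract_contract, contract_comm q p, Fin.succ_castSucc]
  simp

lemma brD_brD (k : ℕ) (z : BRComplex R F (k + 2)) : brD p q k (brD p q (k + 1) z) = 0 := by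
  match k with
  | 0 => exact brD₀_brD₁ p q z
  | 1 => exact brD₁_brD₂ p q z
  | k + 2 => exact brD₂_brD₂ p q k z

section Homotopy

-- The vectors `e` and `e'` are sent by `(p, q)` to the multiples `(M, 0)` and `(*, M)` of the
-- standard basis of `R²`.
variable {p q} {e e' : F} {M : R}

lemma exists_brD₁_eq (hpe : p e = M) (hqe : q e = 0) (hqe' : q e' = M)
    (z : Fin 1 → ⋀[R]^1 F) (hz : brD₀ p q z = 0) : ∃ y, brD₁ p q y = M ^ 2 • z := by
  have h1 : contract p 0 (z 0) = 0 := congrFun hz 0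
  have h2 : contract q 0 (z 0) = 0 := congrFun hz 1
  refine ⟨fun _ => wedge e' 2 (wedge e 1 (z 0)), funext fun j => ?_⟩
  obtain rfl : j = 0 := Subsingleton.elim _ _
  rw [brD₁_apply, contract_wedge, contract_wedge, h2, hqe, hqe', zero_smul, map_zero, sub_zero,
    map_zero, sub_zero, map_smul, contract_wedge, h1, hpe, map_zero, sub_zero, smul_smul, ← sq]
  rfl

lemma exists_brD₂_zero_eq (hpe : p e = M) (hqe : q e = 0) (hqe' : q e' = M)
    (z : Fin 1 → ⋀[R]^3 F) (hz : brD₁ p q z = 0) : ∃ y, brD₂ p q 0 y = M ^ 2 • z := by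
  have h1 : contract p 1 (contract q 2 (z 0)) = 0 := congrFun hz 0
  refine ⟨![M • wedge e 3 (z 0), wedge e' 3 (wedge e 2 (contract p 2 (z 0)))],
    funext fun j => ?_⟩
  obtain rfl : j = 0 := Subsingleton.elim (α := Fin 1) _ _
  change contract p 3 (M • wedge e 3 (z 0)) +
    contract q 3 (wedge e' 3 (wedge e 2 (contract p 2 (z 0)))) = M ^ 2 • z 0
  rw [map_smul, contract_wedge, contract_wedge, contract_wedge, contract_comm q p, h1, hpe, hqe,
    hqe', smul_sub, smul_smul, ← sq]
  simp

lemma exists_brD₂_succ_eq (hpe : p e = M) (hqe : q e = 0) (hqe' : q e' = M) (k : ℕ)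
    (z : Fin (k + 2) → ⋀[R]^(k + 4) F) (hz : brD₂ p q k z = 0) :
    ∃ y, brD₂ p q (k + 1) y = M ^ 2 • z := by
  have hrel (j : Fin (k + 1)) :
      contract q (k + 3) (z j.succ) = -contract p (k + 3) (z j.castSucc) :=
    eq_neg_of_add_eq_zero_right (congrFun hz j)
  refine ⟨Fin.snoc (α := fun _ : Fin (k + 3) => ⋀[R]^(k + 5) F)
    (fun j : Fin (k + 2) => M • wedge e (k + 4) (z j))
    (wedge e' (k + 4) (wedge e (k + 3) (contract p (k + 3) (z (Fin.last (k + 1)))))),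
    funext fun j => ?_⟩
  rw [brD₂_apply, Fin.snoc_castSucc]
  refine Fin.lastCases ?_ (fun i => ?_) j
  · have h1 : contract q (k + 2) (contract p (k + 3) (z (Fin.last (k + 1)))) = 0 := by
      rw [contract_comm, ← Fin.succ_last, hrel, map_neg, contract_contract, neg_zero, neg_zero]
    rw [Fin.succ_last, Fin.snoc_last, map_smul, contract_wedge, contract_wedge, contract_wedge,
      h1, hpe, hqe, hqe', smul_sub, smul_smul, ← sq]
    simp
  · rw [Fin.succ_castSucc, Fin.snoc_castSucc, map_smul, map_smul, contract_wedge, contract_wedge,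
      hpe, hqe, hrel, ← smul_add]
    simp [smul_smul, sq]

end Homotopy

/-- The square of each `2 × 2` minor of `(p, q)` kills the homology of the Buchsbaum-Rim complex in
positive degrees. -/
lemma exists_brD_eq_minor_sq_smul (u v : F) (k : ℕ) (z : BRComplex R F (k + 1))
    (hz : brD p q k z = 0) :
    ∃ y, brD p q (k + 1) y = (p u * q v - p v * q u) ^ 2 • z := by
  have hpe : p (q v • u - q u • v) = p u * q v - p v * q u := by simp; ring
  have hqe : q (q v • u - q u • v) = 0 := by simp; ring
  have hqe' : q (p u • v - p v • u) = p u * q v - p v * q u := by simp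
  match k with
  | 0 => exact exists_brD₁_eq hpe hqe hqe' z hz
  | 1 => exact exists_brD₂_zero_eq hpe hqe hqe' z hz
  | k + 2 => exact exists_brD₂_succ_eq hpe hqe hqe' k z hz

variable {A : Type u} [CommRing A] [Algebra A R]

/-- Exactness at `F = Rⁿ` of the Buchsbaum-Rim complex of an `n × 2` matrix whose `2 × 2` minors
generate an ideal of the largest possible grade `n - 1`: a vector orthogonal to both columns is a
double contraction of an element of `⋀³ F`. -/
theorem exists_contract_contract_eq {n : ℕ} (hn : 2 ≤ n) (𝔪 : Ideal A) (hR : DepthGE 𝔪 (n - 1) R)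
    (p q : Module.Dual R (Fin n → R)) {N : ℕ}
    (hN : ∀ a ∈ 𝔪 ^ N, algebraMap A R a ∈
      Ideal.span {m | ∃ u v : Fin n → R, m = (p u * q v - p v * q u) ^ 2})
    (z : ⋀[R]^1 (Fin n → R)) (hp : contract p 0 z = 0) (hq : contract q 0 z = 0) :
    ∃ y, contract p 1 (contract q 2 y) = z := by
  have hpow (k : ℕ) : ∃ m : ℕ, Nonempty (⋀[R]^k (Fin n → R) ≃ₗ[R] (Fin m → R)) := by
    have b := (Pi.basisFun R (Fin n)).exteriorPower k
    exact ⟨_, ⟨b.equivFun ≪≫ₗ LinearEquiv.funCongrLeft R R (Fintype.equivFin _).symm⟩⟩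
  have := exact_of_depthGE 𝔪 (C := BRComplex R (Fin n → R)) (D := n - 1)
    (fun k => (brD p q k).restrictScalars A) (fun k z => brD_brD p q k z) (by omega) ?_ ?_ ?_ 0
    (fun _ => z) ?_
  · obtain ⟨y, hy⟩ := this
    exact ⟨y (0 : Fin 1), congrFun hy (0 : Fin 1)⟩
  · -- The complex ends at the term with exterior degree `n`.
    intro k hk
    obtain ⟨k, rfl⟩ : ∃ j, k = j + 2 := ⟨k - 2, by omega⟩
    have b := (Pi.basisFun R (Fin n)).exteriorPower (k + 3)
    have : IsEmpty (Set.powersetCard (Fin n) (k + 3)) := by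
      refine ⟨fun s => ?_⟩
      have h1 := Finset.card_le_univ s.1
      have h2 := s.2
      simp only [Set.powersetCard, Set.mem_ofPred_eq, Fintype.card_fin] at h1 h2
      omega
    have : Subsingleton (⋀[R]^(k + 3) (Fin n → R)) := b.repr.toEquiv.subsingleton
    exact inferInstanceAs (Subsingleton (Fin (k + 1) → ⋀[R]^(k + 3) (Fin n → R)))
  · intro k
    obtain ⟨m, ⟨e⟩⟩ := hpow (brDeg k)
    exact DepthGE.pi_fin ((hR.pi_fin m).of_linearEquiv (e.restrictScalars A).symm) _
  · -- The homology is killed by the squares of the minors.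
    intro k
    refine ⟨N, fun z hz a ha => ?_⟩
    have h := hN a ha
    rw [← algebraMap_smul R a z]
    generalize algebraMap A R a = r at h
    induction h using Submodule.span_induction with
    | mem x hx =>
      obtain ⟨u, v, rfl⟩ := hx
      exact exists_brD_eq_minor_sq_smul p q u v k z hz
    | zero => exact ⟨0, by simp⟩
    | add x y _ _ hx hy =>
      obtain ⟨y1, h1⟩ := hx
      obtain ⟨y2, h2⟩ := hy
      exact ⟨y1 + y2, by rw [map_add, h1, h2, add_smul]⟩
    | smul c x _ hx =>
      obtain ⟨y1, h1⟩ := hx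
      refine ⟨c • y1, ?_⟩
      rw [smul_eq_mul, mul_smul, ← h1]
      exact map_smul (brD p q (k + 1)) c y1
  · funext j
    fin_cases j
    · exact hp
    · exact hq

end BuchsbaumRim

/-! ### Vector fields on which two differentials vanish modulo an equation -/

section TrivialFields

variable {n : ℕ}

lemma diff_single_sub (φ h : HolGerm n) (j k : Fin n) :
    diff h (Pi.single k (pd j φ) - Pi.single j (pd k φ)) =
      pd j φ * pd k h - pd k φ * pd j h := by
  simp [diff, Fintype.linearCombination_apply_single, map_sub]

lemma smul_mem_trivialVectorFields (φ : HolGerm n) (η : VectorField n) :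
    φ • η ∈ trivialVectorFields φ := by
  have : φ • η = ∑ i, η i • (Pi.single i φ : VectorField n) := by
    ext j
    simp [Finset.sum_apply, Pi.single_apply, mul_comm]
  rw [this]
  exact sum_mem fun i _ => Submodule.smul_mem _ _ (Submodule.subset_span (Or.inl ⟨i, rfl⟩))

lemma single_sub_mem_trivialVectorFields (φ : HolGerm n) (j k : Fin n) :
    (Pi.single k (pd j φ) - Pi.single j (pd k φ) : VectorField n) ∈ trivialVectorFields φ := by
  by_cases hkj : k = j
  · subst hkj
    simp
  · exact Submodule.subset_span (Or.inr ⟨j, k, hkj, rfl⟩)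

lemma diff_smul_sub_mem_trivialVectorFields (φ : HolGerm n) (b c : VectorField n) :
    diff φ b • c - diff φ c • b ∈ trivialVectorFields φ := by
  have : diff φ b • c - diff φ c • b = ∑ j, ∑ k, (b j * c k) •
      (Pi.single k (pd j φ) - Pi.single j (pd k φ) : VectorField n) := by
    ext i : 1
    simp only [smul_sub, Finset.sum_sub_distrib, Pi.sub_apply, Finset.sum_apply, Pi.smul_apply,
      smul_eq_mul, Pi.single_apply, mul_ite, mul_zero, Finset.sum_ite_eq, Finset.mem_univ,
      if_true, diff_apply, Finset.sum_mul]
    congr 1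
    · exact Finset.sum_congr rfl fun j _ => by ring
    · rw [Finset.sum_comm]
      simp only [Finset.sum_ite_eq, Finset.mem_univ, if_true]
      exact Finset.sum_congr rfl fun j _ => by ring
  rw [this]
  exact sum_mem fun j _ => sum_mem fun k _ =>
    Submodule.smul_mem _ _ (single_sub_mem_trivialVectorFields φ j k)

/-- Every first partial derivative of `φ` multiplies `Θ_X` into `Θ_X^T`. -/
lemma pd_smul_mem_trivialVectorFields {φ : HolGerm n} {ξ : VectorField n}
    (hξ : diff φ ξ ∈ Ideal.span {φ}) (j : Fin n) : pd j φ • ξ ∈ trivialVectorFields φ := by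
  have h := diff_smul_sub_mem_trivialVectorFields φ (Pi.single j 1) ξ
  have h1 : diff φ (Pi.single j 1) = pd j φ := by
    simp [diff, Fintype.linearCombination_apply_single]
  obtain ⟨a, ha⟩ := Ideal.mem_span_singleton'.1 hξ
  rw [h1, ← ha, mul_comm, mul_smul] at h
  have h2 := add_mem h (smul_mem_trivialVectorFields φ (a • Pi.single j 1))
  rwa [sub_add_cancel] at h2

/-- Modulo `φ`, the ideal `df(Θ_X^T)` is generated by the `2 × 2` minors of `(dφ, df)`. -/
lemma diffImage_trivialVectorFields_le (φ f : HolGerm n) :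
    diffImage f (trivialVectorFields φ) ≤
      Ideal.span {φ} ⊔ Ideal.span (Set.range fun x : Fin n × Fin n =>
        pd x.1 φ * pd x.2 f - pd x.2 φ * pd x.1 f) := by
  rw [diffImage, trivialVectorFields, Submodule.map_span, Submodule.span_le]
  rintro _ ⟨ξ, ⟨i, rfl⟩ | ⟨j, k, -, rfl⟩, rfl⟩
  · refine Ideal.mem_sup_left (Ideal.mem_span_singleton.2 ?_)
    simp [diff, Fintype.linearCombination_apply_single]
  · refine Ideal.mem_sup_right (Ideal.subset_span ⟨(j, k), ?_⟩)
    rw [diff_single_sub]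

end TrivialFields

section Syzygies

section Lift

universe u

lemma contractLeft_contractLeft_ι_mul_mul {R F : Type*} [CommRing R] [AddCommGroup F] [Module R F]
    (p q : Module.Dual R F) (a b c : F) :
    CliffordAlgebra.contractLeft p (CliffordAlgebra.contractLeft q
      (ExteriorAlgebra.ι R a * (ExteriorAlgebra.ι R b * ExteriorAlgebra.ι R c))) =
    ExteriorAlgebra.ι R (q a • (p b • c - p c • b) - q b • (p a • c - p c • a) +
      q c • (p a • b - p b • a)) := by
  simp only [ExteriorAlgebra.ι, CliffordAlgebra.contractLeft_ι_mul, CliffordAlgebra.contractLeft_ι,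
    map_sub, map_smul, map_add, mul_sub, ← Algebra.commutes (q c), ← Algebra.smul_def,
    ← Algebra.commutes (p c), mul_smul_comm, smul_sub]
  simp only [← Algebra.commutes, ← Algebra.smul_def]
  module

variable {A : Type u} [CommRing A] {n : ℕ}

/-- The linear form on `(A/I)ⁿ` with coefficients the classes of the `α i`. -/
noncomputable def formMod (I : Ideal A) (α : Fin n → A) : Module.Dual (A ⧸ I) (Fin n → A ⧸ I) :=
  Fintype.linearCombination (A ⧸ I) fun i => Ideal.Quotient.mk I (α i)

lemma formMod_mk (I : Ideal A) (α ξ : Fin n → A) :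
    formMod I α (fun i => Ideal.Quotient.mk I (ξ i)) =
      Ideal.Quotient.mk I (Fintype.linearCombination A α ξ) := by
  simp [formMod, Fintype.linearCombination_apply]

lemma formMod_single (I : Ideal A) (α : Fin n → A) (i : Fin n) :
    formMod I α (Pi.single i 1) = Ideal.Quotient.mk I (α i) := by
  simp [formMod, Fintype.linearCombination_apply_single]

/-- Double contractions of trivectors modulo `I` lift to combinations of the vectors
`p(b) c - p(c) b`, on which both contracting forms vanish. -/
lemma exists_lift_contract_contract (I : Ideal A) (α β : Fin n → A)
    (T : Submodule A (Fin n → A))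
    (hT : ∀ b c, Fintype.linearCombination A α b • c - Fintype.linearCombination A α c • b ∈ T)
    (y : ⋀[A ⧸ I]^3 (Fin n → A ⧸ I)) :
    ∃ τ ∈ T, Fintype.linearCombination A β τ = 0 ∧
      (contract (formMod I α) 1 (contract (formMod I β) 2 y) :
        ExteriorAlgebra (A ⧸ I) (Fin n → A ⧸ I)) =
      ExteriorAlgebra.ι _ fun i => Ideal.Quotient.mk I (τ i) := by
  have hy : (y : ExteriorAlgebra (A ⧸ I) (Fin n → A ⧸ I)) ∈
      Submodule.span (A ⧸ I) (Set.range (ExteriorAlgebra.ιMulti (A ⧸ I) 3)) := by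
    rw [ExteriorAlgebra.ιMulti_span_fixedDegree]
    exact y.2
  rw [coe_contract, coe_contract]
  generalize (y : ExteriorAlgebra (A ⧸ I) (Fin n → A ⧸ I)) = w at hy
  set p := Fintype.linearCombination A α with hp
  set q := Fintype.linearCombination A β with hq
  induction hy using Submodule.span_induction with
  | mem x hx =>
    obtain ⟨v, rfl⟩ := hx
    have hlift (u : Fin n → A ⧸ I) : ∃ ξ : Fin n → A, u = fun i => Ideal.Quotient.mk I (ξ i) :=
      ⟨fun i => (Ideal.Quotient.mk_surjective (u i)).choose,
        funext fun i => (Ideal.Quotient.mk_surjective (u i)).choose_spec.symm⟩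
    obtain ⟨a, ha⟩ := hlift (v 0)
    obtain ⟨b, hb⟩ := hlift (v 1)
    obtain ⟨c, hc⟩ := hlift (v 2)
    refine ⟨q a • (p b • c - p c • b) - q b • (p a • c - p c • a) + q c • (p a • b - p b • a),
      ?_, ?_, ?_⟩
    · exact add_mem (sub_mem (T.smul_mem _ (hT b c)) (T.smul_mem _ (hT a c)))
        (T.smul_mem _ (hT a b))
    · simp only [map_add, map_sub, map_smul, smul_eq_mul]
      ring
    · have h3 : ExteriorAlgebra.ιMulti (A ⧸ I) 3 v =
          ExteriorAlgebra.ι (A ⧸ I) (v 0) * (ExteriorAlgebra.ι (A ⧸ I) (v 1) *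
            ExteriorAlgebra.ι (A ⧸ I) (v 2)) := by
        simp [ExteriorAlgebra.ιMulti_apply]
        rfl
      rw [h3, contractLeft_contractLeft_ι_mul_mul, ha, hb, hc]
      simp only [formMod_mk, ← hp, ← hq]
      congr 1
  | zero => exact ⟨0, zero_mem _, map_zero _, by simp [← Pi.zero_def]⟩
  | add x y _ _ hx hy =>
    obtain ⟨τ₁, h₁, h₁', e₁⟩ := hx
    obtain ⟨τ₂, h₂, h₂', e₂⟩ := hy
    refine ⟨τ₁ + τ₂, add_mem h₁ h₂, by rw [map_add, h₁', h₂', add_zero], ?_⟩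
    rw [map_add, map_add, e₁, e₂, ← map_add]
    congr 1
  | smul r x _ hx =>
    obtain ⟨τ, h, h', e⟩ := hx
    obtain ⟨r, rfl⟩ := Ideal.Quotient.mk_surjective r
    refine ⟨r • τ, Submodule.smul_mem _ _ h, by rw [map_smul, h', smul_zero], ?_⟩
    rw [map_smul, map_smul, e, ← map_smul]
    congr 1

/-- If the `2 × 2` minors of `(α, β)` generate an `𝔪`-primary ideal modulo `I`, then the vectors on
which both forms vanish modulo `I` are, modulo `I`, combinations of the vectors
`p(b) c - p(c) b`, where `p` is the form with coefficients `α`. -/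
theorem exists_sub_mem_of_linearCombination_mem (hn : 2 ≤ n) (𝔪 I : Ideal A)
    (hR : DepthGE 𝔪 (n - 1) (A ⧸ I)) (α β : Fin n → A)
    (T : Submodule A (Fin n → A))
    (hT : ∀ b c, Fintype.linearCombination A α b • c - Fintype.linearCombination A α c • b ∈ T)
    {N : ℕ} (hN : 𝔪 ^ N ≤ I ⊔ Ideal.span (Set.range fun x : Fin n × Fin n =>
      α x.1 * β x.2 - α x.2 * β x.1))
    {ξ : Fin n → A} (hα : Fintype.linearCombination A α ξ ∈ I)
    (hβ : Fintype.linearCombination A β ξ ∈ I) :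
    ∃ τ ∈ T, Fintype.linearCombination A β τ = 0 ∧ ∀ i, ξ i - τ i ∈ I := by
  set J : Ideal (A ⧸ I) := Ideal.span (Set.range fun x : Fin n × Fin n =>
    Ideal.Quotient.mk I (α x.1 * β x.2 - α x.2 * β x.1)) with hJ
  set S : Ideal (A ⧸ I) := Ideal.span {m | ∃ u v : Fin n → A ⧸ I,
    m = (formMod I α u * formMod I β v - formMod I α v * formMod I β u) ^ 2} with hS
  have hJS : J ≤ S.radical := by
    rw [hJ, Ideal.span_le]
    rintro _ ⟨⟨j, k⟩, rfl⟩
    refine ⟨2, Ideal.subset_span ⟨Pi.single j 1, Pi.single k 1, ?_⟩⟩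
    simp only [formMod_single, map_sub, map_mul]
  obtain ⟨K, hK⟩ := Ideal.exists_pow_le_of_le_radical_of_fg hJS
    (Submodule.fg_span (Set.finite_range _))
  have hmap : Ideal.map (Ideal.Quotient.mk I) (𝔪 ^ N) ≤ J := by
    refine (Ideal.map_mono hN).trans ?_
    rw [Ideal.map_sup, Ideal.map_quotient_self, bot_sup_eq, Ideal.map_span, ← Set.range_comp]
    rfl
  have hpow : ∀ a ∈ 𝔪 ^ (N * K), algebraMap A (A ⧸ I) a ∈ S := by
    intro a ha
    refine hK (Ideal.pow_right_mono hmap K ?_)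
    rw [← Ideal.map_pow, ← pow_mul]
    exact Ideal.mem_map_of_mem _ ha
  have hz : ExteriorAlgebra.ι (A ⧸ I) (fun i => Ideal.Quotient.mk I (ξ i)) ∈
      ⋀[A ⧸ I]^1 (Fin n → A ⧸ I) := by
    rw [ExteriorAlgebra.exteriorPower, pow_one]
    exact ⟨_, rfl⟩
  have hcontr {γ : Fin n → A} (hγ : Fintype.linearCombination A γ ξ ∈ I) :
      contract (formMod I γ) 0 ⟨_, hz⟩ = 0 := by
    refine Subtype.ext ?_
    rw [coe_contract]
    change CliffordAlgebra.contractLeft _ (CliffordAlgebra.ι _ _) = 0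
    rw [CliffordAlgebra.contractLeft_ι, formMod_mk, Ideal.Quotient.eq_zero_iff_mem.2 hγ, map_zero]
  obtain ⟨y, hy⟩ := exists_contract_contract_eq hn 𝔪 hR (formMod I α) (formMod I β) hpow _
    (hcontr hα) (hcontr hβ)
  obtain ⟨τ, hτ, hτβ, hτy⟩ := exists_lift_contract_contract I α β T hT y
  rw [hy] at hτy
  have hξτ := (ExteriorAlgebra.ι_leftInverse (R := A ⧸ I)).injective hτy
  exact ⟨τ, hτ, hτβ, fun i => Ideal.Quotient.eq.1 (congrFun hξτ i)⟩

end Lift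

variable {n : ℕ}

/-- If the `2 × 2` minors of `(dφ, df)` generate an ideal of finite colength modulo `φ`, then the
vector fields on which both `dφ` and `df` vanish modulo `φ` are the obvious ones. -/
theorem exists_eq_add_smul_of_diff_mem {φ f : HolGerm n} (hn : 2 ≤ n) (𝔪 : Ideal (HolGerm n))
    (hR : DepthGE 𝔪 (n - 1) (HolGerm n ⧸ Ideal.span {φ})) {N : ℕ}
    (hN : 𝔪 ^ N ≤ diffImage f (trivialVectorFields φ) ⊔ Ideal.span {φ}) {ξ : VectorField n}
    (hφ : diff φ ξ ∈ Ideal.span {φ}) (hf : diff f ξ ∈ Ideal.span {φ}) :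
    ∃ τ ∈ trivialVectorFields φ, diff f τ = 0 ∧ ∃ η, ξ = τ + φ • η := by
  obtain ⟨τ, hτ, hτf, h⟩ := exists_sub_mem_of_linearCombination_mem hn 𝔪 (Ideal.span {φ}) hR
    (fun i => pd i φ) (fun i => pd i f) (trivialVectorFields φ)
    (diff_smul_sub_mem_trivialVectorFields φ)
    (hN.trans (sup_le (diffImage_trivialVectorFields_le φ f) le_sup_left)) hφ hf
  choose η hη using fun i => Ideal.mem_span_singleton'.1 (h i)
  refine ⟨τ, hτ, hτf, η, ?_⟩
  ext i : 1
  rw [Pi.add_apply, Pi.smul_apply, smul_eq_mul, mul_comm, hη]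
  ring

end Syzygies

/-! ### The isomorphisms and colon ideals, derived from the kernel property -/

section Consequences

lemma nonempty_quotient_equiv {A E B : Type*} [CommRing A] [AddCommGroup E] [Module A E]
    [AddCommGroup B] [Module A B] (g : E →ₗ[A] B) (T : Submodule A E) {P Q : Submodule A B}
    (hP : ∀ e, g e ∈ P) (hsurj : ∀ x ∈ P, ∃ e, x - g e ∈ Q) (hker : ∀ e, g e ∈ Q ↔ e ∈ T) :
    Nonempty ((E ⧸ T) ≃ₗ[A] (P ⧸ Q.submoduleOf P)) := by
  set G : E →ₗ[A] P ⧸ Q.submoduleOf P := (Q.submoduleOf P).mkQ ∘ₗ g.codRestrict P hP with hG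
  have hT : T = LinearMap.ker G := by
    ext e
    rw [← hker, LinearMap.mem_ker, hG, LinearMap.comp_apply, Submodule.mkQ_apply,
      Submodule.Quotient.mk_eq_zero, Submodule.submoduleOf, Submodule.mem_comap,
      Submodule.subtype_apply, LinearMap.codRestrict_apply]
  have hGs : Function.Surjective G := by
    intro y
    obtain ⟨⟨x, hx⟩, rfl⟩ := Submodule.mkQ_surjective _ y
    obtain ⟨e, he⟩ := hsurj x hx
    refine ⟨e, ((Submodule.Quotient.eq _).2 ?_).symm⟩
    exact he
  exact ⟨Submodule.quotEquivOfEq _ _ hT ≪≫ₗ G.quotKerEquivOfSurjective hGs⟩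

variable {n : ℕ} {φ f : HolGerm n} {X : Set (Fin n → ℂ)}

lemma diff_mul_apply (ξ : VectorField n) (a g : HolGerm n) :
    diff (a * g) ξ = a * diff g ξ + g * diff a ξ := by
  simp only [diff_apply, pd_mul, mul_add, Finset.sum_add_distrib, Finset.mul_sum]
  congr 1 <;> exact Finset.sum_congr rfl fun i _ => by ring

lemma mem_logVectorFields_iff (h : IsIHS φ X) {ξ : VectorField n} :
    ξ ∈ logVectorFields X ↔ diff φ ξ ∈ Ideal.span {φ} := by
  change (∀ g ∈ vanishingIdeal X, diff g ξ ∈ vanishingIdeal X) ↔ _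
  rw [h.vanishingIdeal_eq]
  refine ⟨fun H => H φ (Ideal.mem_span_singleton_self φ), fun H g hg => ?_⟩
  obtain ⟨a, rfl⟩ := Ideal.mem_span_singleton'.1 hg
  rw [diff_mul_apply]
  exact add_mem (Ideal.mul_mem_left _ _ H)
    (Ideal.mul_mem_right _ _ (Ideal.mem_span_singleton_self φ))

lemma mem_jacobianIdeal_iff {h a : HolGerm n} : a ∈ jacobianIdeal h ↔ ∃ η, diff h η = a := by
  rw [jacobianIdeal, Ideal.mem_span_range_iff_exists_fun]
  simp only [diff_apply]

lemma jacobianIdeal_mul_le (φ f : HolGerm n) :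
    jacobianIdeal f * Ideal.span {φ} ≤ diffImage f (trivialVectorFields φ) := by
  refine Ideal.mul_le.2 fun a ha b hb => ?_
  obtain ⟨η, rfl⟩ := mem_jacobianIdeal_iff.1 ha
  obtain ⟨c, rfl⟩ := Ideal.mem_span_singleton'.1 hb
  refine ⟨φ • (c • η), smul_mem_trivialVectorFields φ _, ?_⟩
  rw [map_smul, map_smul, smul_eq_mul, smul_eq_mul]
  ring

/-- `Jφ + (φ)` multiplies `df(Θ_X) + I_X` into `df(Θ_X^T) + I_X`. -/
lemma jacobianIdeal_sup_mul_relDiffImage_le (f : HolGerm n) (h : IsIHS φ X) :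
    (jacobianIdeal φ ⊔ Ideal.span {φ}) * relDiffImage f X ≤
      diffImage f (trivialVectorFields φ) ⊔ Ideal.span {φ} := by
  rw [relDiffImage, h.vanishingIdeal_eq, Ideal.mul_sup, Ideal.sup_mul]
  refine sup_le (sup_le ?_ (Ideal.mul_le_left.trans le_sup_right))
    (Ideal.mul_le_right.trans le_sup_right)
  refine le_trans (Ideal.mul_le.2 ?_) le_sup_left
  rintro a ha _ ⟨ξ, hξ, rfl⟩
  obtain ⟨η, rfl⟩ := mem_jacobianIdeal_iff.1 ha
  rw [diff_apply φ, Finset.sum_mul]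
  refine sum_mem fun j _ => ?_
  rw [mul_assoc]
  refine Ideal.mul_mem_left _ _ ⟨pd j φ • ξ, ?_, map_smul _ _ _⟩
  exact pd_smul_mem_trivialVectorFields ((mem_logVectorFields_iff h).1 hξ) j

/-- The isomorphisms and colon ideals follow from the description of the fields `ξ ∈ Θ_X` with
`df(ξ) ∈ I_X`: each isomorphism is induced by `df` or by multiplication with `φ`, and the
description gives the kernel. -/
theorem isomorphisms_and_colon_eq (hX : IsIHS φ X) (hreg : ∀ a, a * φ = 0 → a = 0)
    (key : ∀ ξ, diff φ ξ ∈ Ideal.span {φ} → diff f ξ ∈ Ideal.span {φ} →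
      ∃ τ ∈ trivialVectorFields φ, diff f τ = 0 ∧ ∃ η, ξ = τ + φ • η) :
    Nonempty
      ((logVectorFields X ⧸ (trivialVectorFields φ).submoduleOf (logVectorFields X))
        ≃ₗ[HolGerm n]
        (↥(diffImage f (logVectorFields X) ⊔ vanishingIdeal X) ⧸
          (diffImage f (trivialVectorFields φ) ⊔ vanishingIdeal X).submoduleOf
            (diffImage f (logVectorFields X) ⊔ vanishingIdeal X))) ∧
    Nonempty
      ((logVectorFields X ⧸ (trivialVectorFields φ).submoduleOf (logVectorFields X))
        ≃ₗ[HolGerm n]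
        (↥(diffImage f (logVectorFields X)) ⧸
          (diffImage f (trivialVectorFields φ)).submoduleOf (diffImage f (logVectorFields X)))) ∧
    diffImage f (logVectorFields X) ⊓ vanishingIdeal X = jacobianIdeal f * vanishingIdeal X ∧
    Nonempty
      ((HolGerm n ⧸ jacobianIdeal f)
        ≃ₗ[HolGerm n]
        (↥(relDiffImage f X) ⧸
          (diffImage f (logVectorFields X)).submoduleOf (relDiffImage f X))) ∧
    (diffImage f (logVectorFields X)).colon (vanishingIdeal X : Set (HolGerm n)) =
      jacobianIdeal f ∧
    (diffImage f (trivialVectorFields φ)).colon (vanishingIdeal X : Set (HolGerm n)) =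
      jacobianIdeal f := by
  have hlog {ξ : VectorField n} : ξ ∈ logVectorFields X ↔ diff φ ξ ∈ Ideal.span {φ} :=
    mem_logVectorFields_iff hX
  have hle := trivialVectorFields_le hX
  have hI := hX.vanishingIdeal_eq
  have hdf (η : VectorField n) : diff f η ∈ jacobianIdeal f :=
    mem_jacobianIdeal_iff.2 ⟨η, rfl⟩
  -- A field in `Θ_X` whose image lies in `df(Θ_X^T) + I_X` is trivial.
  have hker {ξ : VectorField n} (hξ : ξ ∈ logVectorFields X)
      (h : diff f ξ ∈ diffImage f (trivialVectorFields φ) ⊔ vanishingIdeal X) :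
      ξ ∈ trivialVectorFields φ := by
    obtain ⟨_, ⟨τ, hτ, rfl⟩, b, hb, hab⟩ := Submodule.mem_sup.1 h
    rw [hI] at hb
    obtain ⟨τ', hτ', -, η, hη⟩ := key (ξ - τ) (by
      rw [map_sub]
      exact sub_mem (hlog.1 hξ) (hlog.1 (hle hτ))) (by
      rw [map_sub, ← hab, add_sub_cancel_left]
      exact hb)
    rw [← sub_add_cancel ξ τ, hη]
    exact add_mem (add_mem hτ' (smul_mem_trivialVectorFields φ η)) hτ
  have hmem {a : HolGerm n} (ha : a * φ ∈ diffImage f (logVectorFields X)) :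
      a ∈ jacobianIdeal f := by
    obtain ⟨ξ, hξ, h⟩ := ha
    obtain ⟨τ, -, hτ, η, rfl⟩ := key ξ (hlog.1 hξ) (by
      rw [h]
      exact Ideal.mul_mem_left _ _ (Ideal.mem_span_singleton_self φ))
    rw [map_add, hτ, zero_add, map_smul, smul_eq_mul] at h
    have : a = diff f η := by
      rw [← sub_eq_zero]
      refine hreg _ ?_
      rw [sub_mul, ← h]
      ring
    rw [this]
    exact hdf η
  have hmul {a : HolGerm n} (ha : a ∈ jacobianIdeal f) :
      a * φ ∈ diffImage f (trivialVectorFields φ) :=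
    jacobianIdeal_mul_le φ f (Ideal.mul_mem_mul ha (Ideal.mem_span_singleton_self φ))
  have hmono : diffImage f (trivialVectorFields φ) ≤ diffImage f (logVectorFields X) :=
    Submodule.map_mono hle
  have hcolon (I : Ideal (HolGerm n)) (h1 : diffImage f (trivialVectorFields φ) ≤ I)
      (h2 : I ≤ diffImage f (logVectorFields X)) :
      I.colon (vanishingIdeal X : Set (HolGerm n)) = jacobianIdeal f := by
    ext a
    rw [hI, Submodule.mem_colon]
    refine ⟨fun h => hmem (h2 (h φ (Ideal.mem_span_singleton_self φ))), fun h b hb => ?_⟩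
    obtain ⟨c, rfl⟩ := Ideal.mem_span_singleton'.1 hb
    rw [smul_eq_mul, mul_left_comm]
    exact Ideal.mul_mem_left _ _ (h1 (hmul h))
  refine ⟨?_, ?_, ?_, ?_, hcolon _ hmono le_rfl, hcolon _ le_rfl hmono⟩
  · refine nonempty_quotient_equiv ((diff f).domRestrict (logVectorFields X)) _ ?_ ?_ ?_
    · exact fun ξ => Submodule.mem_sup_left ⟨ξ, ξ.2, rfl⟩
    · intro x hx
      obtain ⟨_, ⟨ξ, hξ, rfl⟩, b, hb, rfl⟩ := Submodule.mem_sup.1 hx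
      exact ⟨⟨ξ, hξ⟩, Submodule.mem_sup_right (by simpa using hb)⟩
    · exact fun ξ => ⟨hker ξ.2, fun h => Submodule.mem_sup_left ⟨ξ, h, rfl⟩⟩
  · refine nonempty_quotient_equiv ((diff f).domRestrict (logVectorFields X)) _ ?_ ?_ ?_
    · exact fun ξ => ⟨ξ, ξ.2, rfl⟩
    · rintro _ ⟨ξ, hξ, rfl⟩
      exact ⟨⟨ξ, hξ⟩, by simp⟩
    · exact fun ξ => ⟨fun h => hker ξ.2 (Submodule.mem_sup_left h), fun h => ⟨ξ, h, rfl⟩⟩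
  · rw [hI]
    refine le_antisymm ?_ (le_inf ((jacobianIdeal_mul_le φ f).trans hmono) Ideal.mul_le_right)
    rintro _ ⟨h1, h2⟩
    obtain ⟨a, rfl⟩ := Ideal.mem_span_singleton'.1 h2
    exact Ideal.mul_mem_mul (hmem h1) (Ideal.mem_span_singleton_self φ)
  · refine nonempty_quotient_equiv (LinearMap.toSpanSingleton (HolGerm n) (HolGerm n) φ) _ ?_ ?_ ?_
    · intro a
      refine Submodule.mem_sup_right ?_
      rw [hI]
      exact Ideal.mem_span_singleton'.2 ⟨a, rfl⟩
    · intro x hx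
      obtain ⟨y, hy, b, hb, rfl⟩ := Submodule.mem_sup.1 hx
      rw [hI] at hb
      obtain ⟨a, rfl⟩ := Ideal.mem_span_singleton'.1 hb
      exact ⟨a, by simpa using hy⟩
    · exact fun a => ⟨hmem, fun h => hmono (hmul h)⟩

end Consequences

/-! ### Convergent power series -/

section PowerSeries

open scoped ENNReal NNReal
open MvPowerSeries (coeff)

variable {n : ℕ}

/-- The monomial `x^α`. -/
def mon {S : Type*} [CommMonoid S] (x : Fin n → S) (α : Fin n →₀ ℕ) : S := ∏ i, x i ^ α i

lemma mon_add {S : Type*} [CommMonoid S] (x : Fin n → S) (α β : Fin n →₀ ℕ) :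
    mon x (α + β) = mon x α * mon x β := by
  simp [mon, pow_add, Finset.prod_mul_distrib]

lemma mon_zero {S : Type*} [CommMonoid S] (x : Fin n → S) : mon x 0 = 1 := by
  simp [mon]

lemma mon_single {S : Type*} [CommMonoid S] (x : Fin n → S) (i : Fin n) (k : ℕ) :
    mon x (Finsupp.single i k) = x i ^ k := by
  classical
  rw [mon, Finset.prod_eq_single i]
  · simp
  · intro j _ hj
    simp [hj.symm]
  · simp

lemma mon_const {S : Type*} [CommMonoid S] (r : S) (α : Fin n →₀ ℕ) :
    mon (fun _ => r) α = r ^ α.degree := by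
  rw [mon, Finset.prod_pow_eq_pow_sum, Finsupp.degree_eq_sum]

lemma mon_mono {v w : Fin n → ℝ≥0} (h : v ≤ w) (α : Fin n →₀ ℕ) : mon v α ≤ mon w α :=
  Finset.prod_le_prod' fun i _ => pow_le_pow_left' (h i) _

lemma mon_pos {w : Fin n → ℝ≥0} (h : ∀ i, 0 < w i) (α : Fin n →₀ ℕ) : 0 < mon w α :=
  Finset.prod_pos fun i _ => pow_pos (h i) _

lemma nnnorm_mon (x : Fin n → ℂ) (α : Fin n →₀ ℕ) : ‖mon x α‖₊ = mon (fun i => ‖x i‖₊) α := by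
  simp [mon, nnnorm_prod]

/-- The norm `∑ |c_α| w^α` of a formal power series, for a polyradius `w`. -/
def wnorm (w : Fin n → ℝ≥0) (f : MvPowerSeries (Fin n) ℂ) : ℝ≥0∞ :=
  ∑' α, ((‖coeff α f‖₊ * mon w α : ℝ≥0) : ℝ≥0∞)

/-- A power series converges if it has a finite norm for some polyradius with positive entries. -/
def Conv (f : MvPowerSeries (Fin n) ℂ) : Prop :=
  ∃ w : Fin n → ℝ≥0, (∀ i, 0 < w i) ∧ wnorm w f ≠ ∞

/-- The sum of a power series at a point. It has a meaning where the series converges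
absolutely. -/
def ev (f : MvPowerSeries (Fin n) ℂ) (x : Fin n → ℂ) : ℂ := ∑' α, coeff α f * mon x α

lemma wnorm_mono_weight {v w : Fin n → ℝ≥0} (h : v ≤ w) (f : MvPowerSeries (Fin n) ℂ) :
    wnorm v f ≤ wnorm w f :=
  ENNReal.tsum_le_tsum fun α => by gcongr; exact mon_mono h α

lemma wnorm_add_le (w : Fin n → ℝ≥0) (f g : MvPowerSeries (Fin n) ℂ) :
    wnorm w (f + g) ≤ wnorm w f + wnorm w g := by
  rw [wnorm, wnorm, wnorm, ← ENNReal.tsum_add]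
  refine ENNReal.tsum_le_tsum fun α => ?_
  rw [← ENNReal.coe_add, ← add_mul, map_add]
  gcongr
  exact nnnorm_add_le _ _

lemma wnorm_neg (w : Fin n → ℝ≥0) (f : MvPowerSeries (Fin n) ℂ) : wnorm w (-f) = wnorm w f := by
  simp [wnorm]

lemma wnorm_mul_le (w : Fin n → ℝ≥0) (f g : MvPowerSeries (Fin n) ℂ) :
    wnorm w (f * g) ≤ wnorm w f * wnorm w g := by
  classical
  have h : wnorm w f * wnorm w g = ∑' x : (Fin n →₀ ℕ) × (Fin n →₀ ℕ),
      (((‖coeff x.1 f‖₊ * mon w x.1) * (‖coeff x.2 g‖₊ * mon w x.2) : ℝ≥0) : ℝ≥0∞) := by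
    rw [wnorm, wnorm, ENNReal.tsum_prod (f := fun α β =>
        (((‖coeff α f‖₊ * mon w α) * (‖coeff β g‖₊ * mon w β) : ℝ≥0) : ℝ≥0∞)),
      ← ENNReal.tsum_mul_right]
    refine tsum_congr fun α => ?_
    rw [← ENNReal.tsum_mul_left]
    exact tsum_congr fun β => (ENNReal.coe_mul _ _).symm
  rw [h, ← Finset.HasAntidiagonal.sigmaAntidiagonalEquivProd.tsum_eq, ENNReal.tsum_sigma']
  refine ENNReal.tsum_le_tsum fun α => ?_
  rw [MvPowerSeries.coeff_mul, tsum_fintype, ← ENNReal.ofNNReal_finsetSum, ENNReal.coe_le_coe]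
  refine (mul_le_mul_left (nnnorm_sum_le _ _) _).trans ?_
  rw [Finset.sum_mul, ← Finset.sum_coe_sort]
  refine Finset.sum_le_sum fun x _ => le_of_eq ?_
  have hx : x.1.1 + x.1.2 = α := Finset.HasAntidiagonal.mem_antidiagonal.1 x.2
  simp only [Finset.HasAntidiagonal.sigmaAntidiagonalEquivProd_apply, nnnorm_mul, ← hx, mon_add]
  ring

lemma exists_common_weight {f g : MvPowerSeries (Fin n) ℂ} (hf : Conv f) (hg : Conv g) :
    ∃ w : Fin n → ℝ≥0, (∀ i, 0 < w i) ∧ wnorm w f ≠ ∞ ∧ wnorm w g ≠ ∞ := by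
  obtain ⟨v, hv, hf⟩ := hf
  obtain ⟨w, hw, hg⟩ := hg
  exact ⟨v ⊓ w, fun i => lt_min (hv i) (hw i),
    ((wnorm_mono_weight inf_le_left f).trans_lt hf.lt_top).ne,
    ((wnorm_mono_weight inf_le_right g).trans_lt hg.lt_top).ne⟩

lemma Conv.add {f g : MvPowerSeries (Fin n) ℂ} (hf : Conv f) (hg : Conv g) : Conv (f + g) := by
  obtain ⟨w, hw, hf, hg⟩ := exists_common_weight hf hg
  exact ⟨w, hw, ((wnorm_add_le w f g).trans_lt (ENNReal.add_lt_top.2 ⟨hf.lt_top, hg.lt_top⟩)).ne⟩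

lemma Conv.mul {f g : MvPowerSeries (Fin n) ℂ} (hf : Conv f) (hg : Conv g) : Conv (f * g) := by
  obtain ⟨w, hw, hf, hg⟩ := exists_common_weight hf hg
  exact ⟨w, hw, ((wnorm_mul_le w f g).trans_lt (ENNReal.mul_lt_top hf.lt_top hg.lt_top)).ne⟩

lemma Conv.neg {f : MvPowerSeries (Fin n) ℂ} (hf : Conv f) : Conv (-f) := by
  obtain ⟨w, hw, hf⟩ := hf
  exact ⟨w, hw, by rwa [wnorm_neg]⟩

lemma wnorm_monomial (w : Fin n → ℝ≥0) (α : Fin n →₀ ℕ) (c : ℂ) :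
    wnorm w (MvPowerSeries.monomial α c) = ((‖c‖₊ * mon w α : ℝ≥0) : ℝ≥0∞) := by
  classical
  rw [wnorm, tsum_eq_single α]
  · simp
  · intro β hβ
    simp [MvPowerSeries.coeff_monomial, hβ]

lemma conv_monomial (α : Fin n →₀ ℕ) (c : ℂ) : Conv (MvPowerSeries.monomial α c) :=
  ⟨1, fun _ => one_pos, by rw [wnorm_monomial]; exact ENNReal.coe_ne_top⟩

lemma summable_of_wnorm_ne_top {w : Fin n → ℝ≥0} {f : MvPowerSeries (Fin n) ℂ}
    (hf : wnorm w f ≠ ∞) : Summable fun α => ‖coeff α f‖₊ * mon w α :=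
  ENNReal.tsum_coe_ne_top_iff_summable.1 hf

lemma summable_nnnorm_of_wnorm_ne_top {w : Fin n → ℝ≥0} {f : MvPowerSeries (Fin n) ℂ}
    (hf : wnorm w f ≠ ∞) {x : Fin n → ℂ} (hx : ∀ i, ‖x i‖₊ ≤ w i) :
    Summable fun α => ‖coeff α f * mon x α‖₊ := by
  refine NNReal.summable_of_le (fun α => ?_) (summable_of_wnorm_ne_top hf)
  rw [nnnorm_mul, nnnorm_mon]
  gcongr
  exact mon_mono hx α

lemma summable_of_le_weight {w : Fin n → ℝ≥0} {f : MvPowerSeries (Fin n) ℂ}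
    (hf : wnorm w f ≠ ∞) {x : Fin n → ℂ} (hx : ∀ i, ‖x i‖₊ ≤ w i) :
    Summable fun α => coeff α f * mon x α :=
  (summable_nnnorm_of_wnorm_ne_top hf hx).of_nnnorm

lemma ev_add {w : Fin n → ℝ≥0} {f g : MvPowerSeries (Fin n) ℂ} (hf : wnorm w f ≠ ∞)
    (hg : wnorm w g ≠ ∞) {x : Fin n → ℂ} (hx : ∀ i, ‖x i‖₊ ≤ w i) :
    ev (f + g) x = ev f x + ev g x := by
  rw [ev, ev, ev, ← (summable_of_le_weight hf hx).tsum_add (summable_of_le_weight hg hx)]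
  simp only [map_add, add_mul]

lemma ev_mul {w : Fin n → ℝ≥0} {f g : MvPowerSeries (Fin n) ℂ} (hf : wnorm w f ≠ ∞)
    (hg : wnorm w g ≠ ∞) {x : Fin n → ℂ} (hx : ∀ i, ‖x i‖₊ ≤ w i) :
    ev (f * g) x = ev f x * ev g x := by
  classical
  have h1 := summable_of_le_weight hf hx
  have h2 := summable_of_le_weight hg hx
  have h3 := summable_mul_of_summable_norm h1.norm h2.norm
  rw [ev, ev, ev, h1.tsum_mul_tsum_eq_tsum_sum_antidiagonal h2 h3]
  refine tsum_congr fun α => ?_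
  rw [MvPowerSeries.coeff_mul, Finset.sum_mul]
  refine Finset.sum_congr rfl fun x hx => ?_
  rw [← Finset.HasAntidiagonal.mem_antidiagonal.1 hx, mon_add]
  ring

lemma ev_monomial (α : Fin n →₀ ℕ) (c : ℂ) (x : Fin n → ℂ) :
    ev (MvPowerSeries.monomial α c) x = c * mon x α := by
  classical
  rw [ev, tsum_eq_single α]
  · simp
  · intro β hβ
    simp [MvPowerSeries.coeff_monomial, hβ]

lemma ev_zero_right (f : MvPowerSeries (Fin n) ℂ) : ev f 0 = coeff 0 f := by
  rw [ev, tsum_eq_single 0]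
  · simp [mon_zero]
  · intro α hα
    obtain ⟨i, hi⟩ : ∃ i, α i ≠ 0 := by
      by_contra! h
      exact hα (Finsupp.ext h)
    have : mon (0 : Fin n → ℂ) α = 0 := Finset.prod_eq_zero (Finset.mem_univ i) (by simp [hi])
    rw [this, mul_zero]

lemma eventually_le_weight {w : Fin n → ℝ≥0} (hw : ∀ i, 0 < w i) :
    ∀ᶠ x : Fin n → ℂ in 𝓝 0, ∀ i, ‖x i‖₊ ≤ w i := by
  refine eventually_all.2 fun i => ?_
  have h : Continuous fun x : Fin n → ℂ => ‖x i‖₊ := (continuous_apply i).nnnorm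
  exact (h.tendsto 0).eventually (ge_mem_nhds (by simpa using hw i))

end PowerSeries

/-! ### Analytic functions and convergent power series -/

section Expansion

open scoped ENNReal NNReal
open MvPowerSeries (coeff)

variable {n : ℕ}

/-- The multilinear form `(v_j) ↦ ∏ j, (v_j)_{s j}` attached to a word `s`. -/
def wordForm {k : ℕ} (s : Fin k → Fin n) :
    ContinuousMultilinearMap ℂ (fun _ : Fin k => Fin n → ℂ) ℂ :=
  (ContinuousMultilinearMap.mkPiAlgebra ℂ (Fin k) ℂ).compContinuousLinearMap
    fun j => ContinuousLinearMap.proj (s j)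

lemma wordForm_apply {k : ℕ} (s : Fin k → Fin n) (x : Fin n → ℂ) :
    wordForm s (fun _ => x) = ∏ j, x (s j) := by
  simp [wordForm]

lemma norm_wordForm_le {k : ℕ} (s : Fin k → Fin n) : ‖wordForm s‖ ≤ 1 := by
  refine (ContinuousMultilinearMap.norm_compContinuousLinearMap_le _ _).trans ?_
  rw [ContinuousMultilinearMap.norm_mkPiAlgebra, one_mul]
  refine Finset.prod_le_one (fun _ _ => norm_nonneg _) fun j _ => ?_
  refine ContinuousLinearMap.opNorm_le_bound _ zero_le_one fun x => ?_
  rw [one_mul]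
  exact norm_le_pi_norm x (s j)

/-- The exponent vector of a word. -/
def content {k : ℕ} (s : Fin k → Fin n) : Fin n →₀ ℕ := ∑ j, Finsupp.single (s j) 1

lemma mon_content {S : Type*} [CommMonoid S] {k : ℕ} (s : Fin k → Fin n) (x : Fin n → S) :
    mon x (content s) = ∏ j, x (s j) := by
  induction k with
  | zero => simp [content, mon_zero]
  | succ k ih =>
    have : content s = Finsupp.single (s 0) 1 + content (fun j => s j.succ) := by
      simp [content, Fin.sum_univ_succ]
    rw [this, mon_add, mon_single, ih, Fin.prod_univ_succ, pow_one]

lemma degree_content {k : ℕ} (s : Fin k → Fin n) : (content s).degree = k := by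
  simp [content, map_sum, Finsupp.degree_single]

lemma exists_content_eq (k : ℕ) (α : Fin n →₀ ℕ) (hα : α.degree = k) :
    ∃ s : Fin k → Fin n, content s = α := by
  induction k generalizing α with
  | zero => exact ⟨Fin.elim0, by simp [content, (Finsupp.degree_eq_zero_iff α).1 hα]⟩
  | succ k ih =>
    obtain ⟨i, hi⟩ : ∃ i, α i ≠ 0 := by
      by_contra! h
      have : α = 0 := Finsupp.ext h
      simp [this] at hα
    have hle : Finsupp.single i 1 ≤ α := by
      rw [Finsupp.single_le_iff]
      omega
    have hadd : Finsupp.single i 1 + (α - Finsupp.single i 1) = α := add_tsub_cancel_of_le hle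
    obtain ⟨s, hs⟩ := ih (α - Finsupp.single i 1) (by
      have := congrArg Finsupp.degree hadd
      rw [map_add, Finsupp.degree_single, hα] at this
      omega)
    refine ⟨Fin.cons i s, ?_⟩
    rw [content, Fin.sum_univ_succ]
    simp only [Fin.cons_zero, Fin.cons_succ]
    rw [← content, hs, hadd]

/-- The exponent vectors of degree `k`. -/
def degreeFinset (n k : ℕ) : Finset (Fin n →₀ ℕ) := (Finsupp.finite_of_degree_eq k).toFinset

lemma mem_degreeFinset {k : ℕ} {α : Fin n →₀ ℕ} : α ∈ degreeFinset n k ↔ α.degree = k := by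
  simp [degreeFinset]

/-- The form of degree `k` in the expansion of a power series, written with one word for each
exponent vector. -/
def homForm (f : MvPowerSeries (Fin n) ℂ) : FormalMultilinearSeries ℂ (Fin n → ℂ) ℂ := fun k =>
  ∑ α ∈ (degreeFinset n k).attach,
    coeff α.1 f • wordForm
      (exists_content_eq k α.1 (mem_degreeFinset.1 α.2)).choose

lemma homForm_apply (f : MvPowerSeries (Fin n) ℂ) (k : ℕ) (x : Fin n → ℂ) :
    homForm f k (fun _ => x) =
      ∑ α ∈ degreeFinset n k, coeff α f * mon x α := by
  rw [homForm, sum_apply, ← Finset.sum_attach (degreeFinset n k) fun α =>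
    coeff α f * mon x α]
  refine Finset.sum_congr rfl fun α _ => ?_
  have hα : α.1.degree = k := mem_degreeFinset.1 α.2
  have h := (exists_content_eq k α.1 hα).choose_spec
  rw [smul_apply, wordForm_apply, smul_eq_mul, ← mon_content, h]

lemma norm_homForm_le (f : MvPowerSeries (Fin n) ℂ) (k : ℕ) :
    ‖homForm f k‖ ≤ ∑ α ∈ degreeFinset n k, ‖coeff α f‖ := by
  rw [homForm, ← Finset.sum_attach (degreeFinset n k) fun α => ‖coeff α f‖]
  refine norm_sum_le_of_le _ fun α _ => ?_
  rw [norm_smul]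
  exact mul_le_of_le_one_right (norm_nonneg _) (norm_wordForm_le _)

lemma exists_const_weight {f : MvPowerSeries (Fin n) ℂ} (hf : Conv f) :
    ∃ r : ℝ≥0, 0 < r ∧ wnorm (fun _ => r) f ≠ ∞ := by
  obtain ⟨w, hw, hf⟩ := hf
  obtain ⟨r, hr, hrw⟩ : ∃ r : ℝ≥0, 0 < r ∧ ∀ i, r ≤ w i := by
    have h1 : ∀ᶠ r : ℝ≥0 in 𝓝[>] 0, ∀ i, r ≤ w i := eventually_all.2 fun i =>
      mem_nhdsWithin_of_mem_nhds (ge_mem_nhds (hw i))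
    obtain ⟨r, hr, hr0⟩ := (h1.and self_mem_nhdsWithin).exists
    exact ⟨r, hr0, hr⟩
  exact ⟨r, hr, ((wnorm_mono_weight hrw f).trans_lt hf.lt_top).ne⟩

lemma hasSum_homForm {r : ℝ≥0} {f : MvPowerSeries (Fin n) ℂ} (hf : wnorm (fun _ => r) f ≠ ∞)
    {x : Fin n → ℂ} (hx : ∀ i, ‖x i‖₊ ≤ r) :
    HasSum (fun k => homForm f k fun _ => x) (ev f x) := by
  have h := (summable_of_le_weight hf hx).hasSum.tsum_fiberwise Finsupp.degree
  have hk (k : ℕ) : (homForm f k fun _ => x) =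
      ∑' α : ↑(Finsupp.degree ⁻¹' {k} : Set (Fin n →₀ ℕ)), coeff α.1 f * mon x α.1 := by
    rw [homForm_apply, ← Finset.tsum_subtype]
    have : (degreeFinset n k : Set (Fin n →₀ ℕ)) = Finsupp.degree ⁻¹' {k} := by
      ext α
      simp [mem_degreeFinset]
    exact congrArg (fun S : Set (Fin n →₀ ℕ) => ∑' α : S, coeff α.1 f * mon x α.1) this
  simp only [hk]
  exact h

lemma hasFPowerSeriesOnBall_ev {r : ℝ≥0} (hr : 0 < r) {f : MvPowerSeries (Fin n) ℂ}
    (hf : wnorm (fun _ => r) f ≠ ∞) : HasFPowerSeriesOnBall (ev f) (homForm f) 0 r where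
  r_le := by
    have hs := summable_of_wnorm_ne_top hf
    refine FormalMultilinearSeries.le_radius_of_bound _
      (∑' α, ‖coeff α f‖₊ * mon (fun _ => r) α : ℝ≥0) fun k => ?_
    have h1 : ∑ α ∈ degreeFinset n k,
        ‖coeff α f‖₊ * mon (fun _ => r) α ≤ ∑' α, ‖coeff α f‖₊ * mon (fun _ => r) α :=
      hs.sum_le_tsum _ fun _ _ => zero_le
    refine le_trans ?_ (NNReal.coe_le_coe.2 h1)
    refine (mul_le_mul_of_nonneg_right (norm_homForm_le f k) (by positivity)).trans ?_
    rw [Finset.sum_mul, NNReal.coe_sum]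
    refine Finset.sum_le_sum fun α hα => ?_
    rw [mon_const, mem_degreeFinset.1 hα]
    simp
  r_pos := by simpa using hr
  hasSum := fun {y} hy => by
    rw [zero_add]
    refine hasSum_homForm hf fun i => ?_
    have : ‖y‖₊ ≤ r := by
      have := Metric.mem_eball.1 hy
      rw [edist_zero_right] at this
      exact (by exact_mod_cast this : ‖y‖₊ < r).le
    exact (nnnorm_le_pi_nnnorm y i).trans this

lemma Conv.analyticAt_ev {f : MvPowerSeries (Fin n) ℂ} (hf : Conv f) : AnalyticAt ℂ (ev f) 0 := by
  obtain ⟨r, hr, hf⟩ := exists_const_weight hf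
  exact ⟨_, _, hasFPowerSeriesOnBall_ev hr hf⟩

/-- A convergent power series is determined by its sum near `0`. -/
lemma Conv.eq_zero_of_ev {f : MvPowerSeries (Fin n) ℂ} (hf : Conv f) (h : ev f =ᶠ[𝓝 0] 0) :
    f = 0 := by
  obtain ⟨r, hr, hf⟩ := exists_const_weight hf
  have hz := ((hasFPowerSeriesOnBall_ev hr hf).hasFPowerSeriesAt.congr h).apply_eq_zero
  ext α
  set P : MvPolynomial (Fin n) ℂ :=
    ∑ β ∈ degreeFinset n α.degree,
      MvPolynomial.monomial β (coeff β f) with hP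
  have hP0 : P = 0 := by
    refine MvPolynomial.funext fun x => ?_
    rw [map_zero, hP, map_sum, ← hz α.degree x, homForm_apply]
    refine Finset.sum_congr rfl fun β _ => ?_
    rw [MvPolynomial.eval_monomial, mon, Finsupp.prod_fintype _ _ (by simp)]
  have := congrArg (MvPolynomial.coeff α) hP0
  rw [hP, MvPolynomial.coeff_sum, Finset.sum_eq_single α] at this
  · simpa using this
  · intro β _ hβ
    simp [MvPolynomial.coeff_monomial, hβ]
  · intro h
    exact absurd (mem_degreeFinset.2 rfl) h

/-- A function that is analytic at `0` is the sum of a convergent power series near `0`. -/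
lemma exists_conv_ev_eq {F : (Fin n → ℂ) → ℂ} (hF : AnalyticAt ℂ F 0) :
    ∃ f, Conv f ∧ ev f =ᶠ[𝓝 0] F := by
  obtain ⟨p, R, hp⟩ := hF
  obtain ⟨r, hr, hrR⟩ := ENNReal.lt_iff_exists_nnreal_btwn.1 hp.r_pos
  have hr : 0 < r := by simpa using hr
  obtain ⟨a, ⟨ha0, ha1⟩, C, hC, hbound⟩ :=
    p.norm_mul_pow_le_mul_pow_of_lt_radius (hrR.trans_le hp.r_le)
  -- There are `n ^ k` words of length `k`, which is why the radius is divided by `n + 1`.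
  set ρ : ℝ≥0 := r / (n + 1) with hρ
  have hρ0 : 0 < ρ := by positivity
  -- The coefficient of a word; the coefficients with the same exponent vector are collected in `f`.
  set c : (Σ k, Fin k → Fin n) → ℂ := fun s => p s.1 fun j => Pi.single (s.2 j) 1 with hc
  have hcs : Summable fun s : Σ k, Fin k → Fin n => ‖c s‖ * (ρ : ℝ) ^ s.1 := by
    have hle (k : ℕ) : ∑ s : Fin k → Fin n, ‖c ⟨k, s⟩‖ * (ρ : ℝ) ^ k ≤ C * a ^ k := by
      have h1 (s : Fin k → Fin n) : ‖c ⟨k, s⟩‖ ≤ ‖p k‖ := by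
        refine ((p k).le_opNorm _).trans ?_
        refine mul_le_of_le_one_right (norm_nonneg _)
          (Finset.prod_le_one (fun _ _ => norm_nonneg _) fun j _ => ?_)
        rw [Pi.norm_single, norm_one]
      calc ∑ s : Fin k → Fin n, ‖c ⟨k, s⟩‖ * (ρ : ℝ) ^ k
          ≤ ∑ _s : Fin k → Fin n, ‖p k‖ * (ρ : ℝ) ^ k := by
            gcongr with s; exact h1 s
        _ = ‖p k‖ * (n * ρ) ^ k := by
            simp only [Finset.sum_const, Finset.card_univ, Fintype.card_fun, Fintype.card_fin,
              nsmul_eq_mul, Nat.cast_pow]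
            ring
        _ ≤ ‖p k‖ * r ^ k := by
            gcongr
            rw [hρ]
            push_cast
            rw [mul_div_assoc', div_le_iff₀ (by positivity)]
            nlinarith [r.coe_nonneg]
        _ ≤ C * a ^ k := hbound k
    refine (summable_sigma_of_nonneg fun s => by positivity).2
      ⟨fun k => (hasSum_fintype _).summable, ?_⟩
    refine Summable.of_nonneg_of_le (fun k => by positivity) (fun k => ?_)
      ((summable_geometric_of_lt_one ha0.le ha1).mul_left C)
    rw [tsum_fintype]
    exact hle k
  set ct : (Σ k, Fin k → Fin n) → (Fin n →₀ ℕ) := fun s => content s.2 with hct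
  set f : MvPowerSeries (Fin n) ℂ := fun α => ∑' s : ↑(ct ⁻¹' {α}), c s with hf
  have hcoeff (α : Fin n →₀ ℕ) : coeff α f = ∑' s : ↑(ct ⁻¹' {α}), c s := rfl
  have hdeg {s : Σ k, Fin k → Fin n} {α : Fin n →₀ ℕ} (h : ct s = α) : s.1 = α.degree := by
    rw [← h, hct, degree_content]
  have hconv : wnorm (fun _ => ρ) f ≠ ∞ := by
    have h1 : ∑' s : Σ k, Fin k → Fin n, ((‖c s‖₊ * ρ ^ s.1 : ℝ≥0) : ℝ≥0∞) ≠ ∞ := by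
      rw [ENNReal.tsum_coe_ne_top_iff_summable, ← NNReal.summable_coe]
      simpa using hcs
    refine ne_top_of_le_ne_top h1 ?_
    rw [← (Equiv.sigmaFiberEquiv ct).tsum_eq, ENNReal.tsum_sigma']
    refine ENNReal.tsum_le_tsum fun α => ?_
    rw [hcoeff, ENNReal.coe_mul]
    have h2 : (‖∑' s : ↑(ct ⁻¹' {α}), c s‖₊ : ℝ≥0∞) ≤ ∑' s : ↑(ct ⁻¹' {α}), (‖c s‖₊ : ℝ≥0∞) :=
      enorm_tsum_le_tsum_enorm (f := fun s : ↑(ct ⁻¹' {α}) => c s)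
    refine (mul_le_mul_left h2 _).trans ?_
    rw [← ENNReal.tsum_mul_right]
    refine le_of_eq (tsum_congr fun s => ?_)
    rw [← ENNReal.coe_mul, mon_const, ← hdeg s.2]
    rfl
  refine ⟨f, ⟨_, fun _ => hρ0, hconv⟩, ?_⟩
  have hev : ∀ᶠ x : Fin n → ℂ in 𝓝 0, ∀ i, ‖x i‖₊ ≤ ρ := eventually_le_weight fun _ => hρ0
  filter_upwards [hev, Metric.eball_mem_nhds 0 hp.r_pos] with x hx hxR
  have hterm (s : Σ k, Fin k → Fin n) : ‖c s * mon x (ct s)‖ ≤ ‖c s‖ * (ρ : ℝ) ^ s.1 := by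
    rw [norm_mul]
    gcongr
    have := mon_mono hx (ct s)
    rw [← nnnorm_mon, mon_const, hct, degree_content] at this
    exact_mod_cast this
  have hsum : Summable fun s => c s * mon x (ct s) := Summable.of_norm_bounded hcs hterm
  have h1 : HasSum (fun α => ∑' s : ↑(ct ⁻¹' {α}), c s * mon x (ct s))
      (∑' s, c s * mon x (ct s)) := hsum.hasSum.tsum_fiberwise ct
  have h2 : ev f x = ∑' s, c s * mon x (ct s) := by
    rw [ev, ← h1.tsum_eq]
    refine tsum_congr fun α => ?_
    rw [hcoeff, ← tsum_mul_right]
    refine tsum_congr fun s => ?_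
    rw [show ct s = α from s.2]
  rw [h2]
  have h3 := hp.hasSum hxR
  rw [zero_add] at h3
  rw [← h3.tsum_eq, hsum.tsum_sigma' fun k => (hasSum_fintype _).summable]
  refine tsum_congr fun k => ?_
  rw [tsum_fintype]
  have hx' : x = ∑ i, x i • (Pi.single i (1 : ℂ) : Fin n → ℂ) := by
    ext j
    simp [Finset.sum_apply, Pi.single_apply]
  conv_rhs => rw [hx']
  rw [(p k).map_sum fun _ i => x i • (Pi.single i (1 : ℂ) : Fin n → ℂ)]
  refine Finset.sum_congr rfl fun s _ => ?_
  rw [(p k).map_smul_univ, hct, mon_content, smul_eq_mul, mul_comm]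

end Expansion

/-! ### Taylor expansions of germs, and the depth of the ring of germs -/

section Germs

open scoped ENNReal NNReal
open MvPowerSeries (coeff)

variable {n : ℕ}

lemma ext_of_rep {g h : HolGerm n} (H : rep g =ᶠ[𝓝 0] rep h) : g = h := by
  rw [← of_rep g, ← of_rep h]
  exact of_eq_of _ _ H

lemma Conv.ev_add {f g : MvPowerSeries (Fin n) ℂ} (hf : Conv f) (hg : Conv g) :
    ev (f + g) =ᶠ[𝓝 0] ev f + ev g := by
  obtain ⟨w, hw, hf, hg⟩ := exists_common_weight hf hg
  filter_upwards [eventually_le_weight hw] with x hx using BruceRoberts.ev_add hf hg hx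

lemma Conv.ev_mul {f g : MvPowerSeries (Fin n) ℂ} (hf : Conv f) (hg : Conv g) :
    ev (f * g) =ᶠ[𝓝 0] ev f * ev g := by
  obtain ⟨w, hw, hf, hg⟩ := exists_common_weight hf hg
  filter_upwards [eventually_le_weight hw] with x hx using BruceRoberts.ev_mul hf hg hx

lemma ev_neg (f : MvPowerSeries (Fin n) ℂ) (x : Fin n → ℂ) : ev (-f) x = -ev f x := by
  simp [ev, tsum_neg]

lemma Conv.eq_of_ev {f g : MvPowerSeries (Fin n) ℂ} (hf : Conv f) (hg : Conv g)
    (h : ev f =ᶠ[𝓝 0] ev g) : f = g := by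
  rw [← sub_eq_zero, sub_eq_add_neg]
  refine (hf.add hg.neg).eq_zero_of_ev ?_
  filter_upwards [hf.ev_add hg.neg, h] with x h1 h2
  simp [h1, ev_neg, h2]

/-- The Taylor expansion at `0` of a germ. -/
def taylor (g : HolGerm n) : MvPowerSeries (Fin n) ℂ :=
  (exists_conv_ev_eq (analyticAt_rep g)).choose

lemma conv_taylor (g : HolGerm n) : Conv (taylor g) :=
  (exists_conv_ev_eq (analyticAt_rep g)).choose_spec.1

lemma ev_taylor (g : HolGerm n) : ev (taylor g) =ᶠ[𝓝 0] rep g :=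
  (exists_conv_ev_eq (analyticAt_rep g)).choose_spec.2

lemma taylor_eq {g : HolGerm n} {f : MvPowerSeries (Fin n) ℂ} (hf : Conv f)
    (h : ev f =ᶠ[𝓝 0] rep g) : taylor g = f :=
  (conv_taylor g).eq_of_ev hf ((ev_taylor g).trans h.symm)

lemma taylor_injective : Function.Injective (taylor (n := n)) := fun g h H =>
  ext_of_rep ((ev_taylor g).symm.trans (by rw [H]; exact ev_taylor h))

lemma exists_taylor_eq {f : MvPowerSeries (Fin n) ℂ} (hf : Conv f) :
    ∃ g : HolGerm n, taylor g = f :=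
  ⟨HolGerm.of (ev f) hf.analyticAt_ev, taylor_eq hf (rep_of _ _).symm⟩

lemma taylor_add (g h : HolGerm n) : taylor (g + h) = taylor g + taylor h := by
  refine taylor_eq ((conv_taylor g).add (conv_taylor h)) ?_
  filter_upwards [(conv_taylor g).ev_add (conv_taylor h), ev_taylor g, ev_taylor h, rep_add g h]
    with x h1 h2 h3 h4
  simp [h1, h2, h3, h4]

lemma taylor_mul (g h : HolGerm n) : taylor (g * h) = taylor g * taylor h := by
  refine taylor_eq ((conv_taylor g).mul (conv_taylor h)) ?_
  filter_upwards [(conv_taylor g).ev_mul (conv_taylor h), ev_taylor g, ev_taylor h, rep_mul g h]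
    with x h1 h2 h3 h4
  simp [h1, h2, h3, h4]

lemma taylor_zero : taylor (0 : HolGerm n) = 0 := by
  simpa using taylor_add (0 : HolGerm n) 0

lemma analyticAt_coord (i : Fin n) (a : Fin n → ℂ) : AnalyticAt ℂ (fun x : Fin n → ℂ => x i) a :=
  (ContinuousLinearMap.proj (R := ℂ) (φ := fun _ : Fin n => ℂ) i).analyticAt a

/-- The coordinate function `x_i`, as a germ. -/
def coord (i : Fin n) : HolGerm n :=
  HolGerm.of (fun x => x i) (analyticAt_coord i 0)

lemma taylor_coord (i : Fin n) : taylor (coord i) = MvPowerSeries.X i := by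
  refine taylor_eq (conv_monomial _ _) ?_
  filter_upwards [rep_of (fun x : Fin n → ℂ => x i)
    (analyticAt_coord i 0)] with x hx
  rw [coord, hx, MvPowerSeries.X, ev_monomial, mon_single, one_mul, pow_one]

lemma coeff_zero_taylor (g : HolGerm n) : coeff 0 (taylor g) = rep g 0 := by
  rw [← ev_zero_right, (ev_taylor g).self_of_nhds]

lemma mul_eq_zero_of_germ {g h : HolGerm n} (H : g * h = 0) : g = 0 ∨ h = 0 := by
  have := taylor_mul g h
  rw [H, taylor_zero, eq_comm, mul_eq_zero] at this
  exact this.imp (fun h1 => taylor_injective (h1.trans taylor_zero.symm))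
    fun h1 => taylor_injective (h1.trans taylor_zero.symm)

/-- The maximal ideal of the germs that vanish at `0`. -/
def germMaximalIdeal (n : ℕ) : Ideal (HolGerm n) where
  carrier := {g | rep g 0 = 0}
  zero_mem' := rep_zero.self_of_nhds
  add_mem' := fun {g h} (hg : rep g 0 = 0) (hh : rep h 0 = 0) => by
    simp [(rep_add g h).self_of_nhds, hg, hh]
  smul_mem' := fun c g (hg : rep g 0 = 0) => by
    simp [smul_eq_mul, (rep_mul c g).self_of_nhds, hg]

lemma mem_germMaximalIdeal {g : HolGerm n} : g ∈ germMaximalIdeal n ↔ rep g 0 = 0 := Iff.rfl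

lemma isUnit_of_rep_ne_zero {g : HolGerm n} (hg : rep g 0 ≠ 0) : IsUnit g := by
  have hinv : AnalyticAt ℂ (fun x => (rep g x)⁻¹) 0 := (analyticAt_rep g).inv hg
  refine IsUnit.of_mul_eq_one (HolGerm.of _ hinv) (ext_of_rep ?_)
  have h1 : rep (1 : HolGerm n) =ᶠ[𝓝 0] fun _ => 1 := rep_of (fun _ => 1) analyticAt_const
  filter_upwards [rep_mul g (HolGerm.of _ hinv), rep_of _ hinv, h1,
    (analyticAt_rep g).continuousAt.eventually_ne hg] with x h2 h3 h4 h5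
  rw [h2, Pi.mul_apply, h3, h4, mul_inv_cancel₀ h5]

/-- The ideal generated by the coordinates with index in `s`. -/
def coordIdeal (s : Set (Fin n)) : Ideal (HolGerm n) := Ideal.span (coord '' s)

lemma Conv.of_nnnorm_le {f g : MvPowerSeries (Fin n) ℂ} (hf : Conv f)
    (h : ∀ α, ‖coeff α g‖₊ ≤ ‖coeff α f‖₊) : Conv g := by
  obtain ⟨w, hw, hf⟩ := hf
  refine ⟨w, hw, ne_top_of_le_ne_top hf (ENNReal.tsum_le_tsum fun α => ?_)⟩
  gcongr
  exact h α

lemma Conv.of_X_mul {i : Fin n} {q : MvPowerSeries (Fin n) ℂ}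
    (h : Conv (MvPowerSeries.X i * q)) : Conv q := by
  obtain ⟨w, hw, h⟩ := h
  refine ⟨w, hw, ?_⟩
  have h1 : (w i : ℝ≥0∞) * wnorm w q ≤ wnorm w (MvPowerSeries.X i * q) := by
    have hinj : Function.Injective fun α : Fin n →₀ ℕ => Finsupp.single i 1 + α :=
      add_right_injective _
    refine le_trans (le_of_eq ?_) (ENNReal.tsum_comp_le_tsum_of_injective hinj _)
    rw [wnorm, ← ENNReal.tsum_mul_left]
    refine tsum_congr fun α => ?_
    rw [MvPowerSeries.X, MvPowerSeries.coeff_add_monomial_mul, mon_add, mon_single, one_mul,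
      pow_one, ← ENNReal.coe_mul]
    congr 1
    ring
  intro htop
  rw [htop, ENNReal.mul_top (by simpa using (hw i).ne'), top_le_iff] at h1
  exact h h1

/-- An ideal generated by coordinates is described by the vanishing of Taylor coefficients. -/
lemma mem_coordIdeal_iff {s : Set (Fin n)} {g : HolGerm n} :
    g ∈ coordIdeal s ↔ ∀ α : Fin n →₀ ℕ, (∀ i ∈ s, α i = 0) → coeff α (taylor g) = 0 := by
  constructor
  · intro hg
    induction hg using Submodule.span_induction with
    | mem x hx =>
      obtain ⟨i, hi, rfl⟩ := hx
      intro α hα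
      rw [taylor_coord]
      exact MvPowerSeries.X_dvd_iff.1 dvd_rfl α (hα i hi)
    | zero => simp [taylor_zero]
    | add x y _ _ hx hy =>
      intro α hα
      rw [taylor_add, map_add, hx α hα, hy α hα, add_zero]
    | smul c x _ hx =>
      classical
      intro α hα
      rw [smul_eq_mul, taylor_mul, MvPowerSeries.coeff_mul]
      refine Finset.sum_eq_zero fun p hp => ?_
      rw [hx p.2 fun i hi => ?_, mul_zero]
      have := DFunLike.congr_fun (Finset.HasAntidiagonal.mem_antidiagonal.1 hp) i
      rw [Finsupp.add_apply, hα i hi] at this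
      omega
  · classical
    induction s, s.toFinite using Set.Finite.induction_on generalizing g with
    | empty =>
      intro h
      have : taylor g = 0 := MvPowerSeries.ext fun α => h α (by simp)
      rw [taylor_injective (this.trans taylor_zero.symm)]
      exact zero_mem _
    | @insert i s _ _ ih =>
      intro h
      -- Separate the part of the expansion that does not involve `x_i`.
      set f₀ : MvPowerSeries (Fin n) ℂ := fun α =>
        if α i = 0 then coeff α (taylor g) else 0 with hf₀
      have hc₀ (α : Fin n →₀ ℕ) : coeff α f₀ = if α i = 0 then coeff α (taylor g) else 0 := rfl
      have hf₀c : Conv f₀ := (conv_taylor g).of_nnnorm_le fun α => by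
        rw [hc₀]
        split_ifs <;> simp
      obtain ⟨q, hq⟩ : MvPowerSeries.X i ∣ taylor g - f₀ := by
        rw [MvPowerSeries.X_dvd_iff]
        intro α hα
        rw [map_sub, hc₀, if_pos hα, sub_self]
      have hqc : Conv q := Conv.of_X_mul (i := i) (by
        rw [← hq, sub_eq_add_neg]
        exact (conv_taylor g).add hf₀c.neg)
      obtain ⟨g₀, hg₀⟩ := exists_taylor_eq hf₀c
      obtain ⟨b, hb⟩ := exists_taylor_eq hqc
      have hg : g = g₀ + coord i * b := taylor_injective (by
        rw [taylor_add, taylor_mul, taylor_coord, hg₀, hb, ← hq]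
        ring)
      have h₀ : g₀ ∈ coordIdeal s := ih fun α hα => by
        rw [hg₀, hc₀]
        split_ifs with hi
        · refine h α fun j hj => ?_
          rcases hj with rfl | hj
          · exact hi
          · exact hα j hj
        · rfl
      rw [hg]
      refine add_mem (Ideal.span_mono (Set.image_mono (Set.subset_insert _ _)) h₀) ?_
      exact Ideal.mul_mem_right _ _ (Ideal.subset_span ⟨i, Set.mem_insert _ _, rfl⟩)

lemma germMaximalIdeal_eq (n : ℕ) : germMaximalIdeal n = coordIdeal Set.univ := by
  ext g
  rw [mem_coordIdeal_iff, mem_germMaximalIdeal, ← coeff_zero_taylor]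
  constructor
  · intro h α hα
    rwa [show α = 0 from Finsupp.ext fun i => hα i (Set.mem_univ i)]
  · exact fun h => h 0 (by simp)

lemma coord_mem_germMaximalIdeal (i : Fin n) : coord i ∈ germMaximalIdeal n := by
  rw [germMaximalIdeal_eq]
  exact Ideal.subset_span ⟨i, Set.mem_univ i, rfl⟩

/-- The coordinates form a regular sequence. -/
lemma mem_coordIdeal_of_coord_mul_mem {s : Set (Fin n)} {i : Fin n} (hi : i ∉ s) {g : HolGerm n}
    (h : coord i * g ∈ coordIdeal s) : g ∈ coordIdeal s := by
  rw [mem_coordIdeal_iff] at h ⊢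
  intro α hα
  have := h (Finsupp.single i 1 + α) fun j hj => by
    have : i ≠ j := fun h => hi (h ▸ hj)
    simp [hα j hj, this]
  rwa [taylor_mul, taylor_coord, MvPowerSeries.X, MvPowerSeries.coeff_add_monomial_mul,
    one_mul] at this

lemma depthGE_quotient_coordIdeal (j : ℕ) (hj : j ≤ n) :
    DepthGE (germMaximalIdeal n) j (HolGerm n ⧸ coordIdeal {i : Fin n | (i : ℕ) < n - j}) := by
  induction j with
  | zero => exact fun i hi => absurd hi (Nat.not_lt_zero i)
  | succ j ih =>
    set k : Fin n := ⟨n - (j + 1), by omega⟩ with hk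
    set s : Set (Fin n) := {i : Fin n | (i : ℕ) < n - (j + 1)} with hs
    have hks : k ∉ s := by simp [hs, hk]
    have hins : {i : Fin n | (i : ℕ) < n - j} = insert k s := by
      ext i
      simp only [hs, Set.mem_ofPred_eq, Set.mem_insert_iff, Fin.ext_iff, hk]
      omega
    have ih := ih (by omega)
    rw [hins] at ih
    have hle : coordIdeal s ≤ coordIdeal (insert k s) :=
      Ideal.span_mono (Set.image_mono (Set.subset_insert _ _))
    refine DepthGE.of_regular (coord_mem_germMaximalIdeal k)
      (g := Submodule.factor hle) ?_ ?_ (Submodule.factor_surjective hle) ih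
    · rw [← LinearMap.ker_eq_bot, LinearMap.ker_eq_bot']
      intro y hy
      obtain ⟨y, rfl⟩ := Submodule.mkQ_surjective _ y
      rw [LinearMap.lsmul_apply, ← map_smul, Submodule.mkQ_apply,
        Submodule.Quotient.mk_eq_zero] at hy
      rw [Submodule.mkQ_apply, Submodule.Quotient.mk_eq_zero]
      exact mem_coordIdeal_of_coord_mul_mem hks hy
    · intro y
      obtain ⟨y, rfl⟩ := Submodule.mkQ_surjective _ y
      rw [← LinearMap.comp_apply, Submodule.factor_comp_mk, Submodule.mkQ_apply,
        Submodule.mkQ_apply, Submodule.Quotient.mk_eq_zero]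
      constructor
      · intro hy
        rw [coordIdeal, Set.image_insert_eq, Ideal.span_insert, Submodule.mem_sup] at hy
        obtain ⟨a, ha, b, hb, rfl⟩ := hy
        obtain ⟨c, rfl⟩ := Ideal.mem_span_singleton'.1 ha
        refine ⟨Submodule.Quotient.mk c, ?_⟩
        rw [LinearMap.lsmul_apply, ← Submodule.Quotient.mk_smul, Submodule.Quotient.eq]
        have : coord k • c - (c * coord k + b) = -b := by
          rw [smul_eq_mul]
          ring
        rw [this]
        exact neg_mem hb
      · rintro ⟨z, hz⟩
        obtain ⟨z, rfl⟩ := Submodule.mkQ_surjective _ z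
        rw [LinearMap.lsmul_apply, ← map_smul, Submodule.mkQ_apply, Submodule.Quotient.eq] at hz
        have h1 : coord k • z ∈ coordIdeal (insert k s) :=
          Ideal.mul_mem_right _ _ (Ideal.subset_span ⟨k, Set.mem_insert _ _, rfl⟩)
        have h2 := sub_mem h1 (hle hz)
        rwa [sub_sub_cancel] at h2

lemma depthGE_holGerm (n : ℕ) : DepthGE (germMaximalIdeal n) n (HolGerm n) := by
  have h := depthGE_quotient_coordIdeal (n := n) n le_rfl
  refine h.of_linearEquiv (Submodule.quotEquivOfEqBot _ ?_)
  simp [coordIdeal]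

lemma depthGE_quotient_span_singleton {φ : HolGerm n} (hn : 1 ≤ n) (hφ : φ ≠ 0) :
    DepthGE (germMaximalIdeal n) (n - 1) (HolGerm n ⧸ Ideal.span {φ}) := by
  refine DepthGE.of_quotient (f := LinearMap.toSpanSingleton (HolGerm n) (HolGerm n) φ)
    (g := (Ideal.span {φ}).mkQ) ?_ ?_ (Submodule.mkQ_surjective _)
    ((depthGE_holGerm n).mono (by omega)) ((depthGE_holGerm n).mono (by omega))
  · rw [← LinearMap.ker_eq_bot, LinearMap.ker_eq_bot']
    intro a ha
    exact (mul_eq_zero_of_germ ha).resolve_right hφ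
  · intro a
    rw [Submodule.mkQ_apply, Submodule.Quotient.mk_eq_zero]
    exact Ideal.mem_span_singleton'

end Germs

/-! ### Weierstrass division of convergent power series -/

section Division

open scoped ENNReal NNReal
open MvPowerSeries (coeff)

variable {m : ℕ}

/-- The quotient of a power series by `x₀^d`, the terms of degree less than `d` in `x₀` being
dropped. -/
def shift (d : ℕ) (f : MvPowerSeries (Fin (m + 1)) ℂ) : MvPowerSeries (Fin (m + 1)) ℂ :=
  fun α => coeff (Finsupp.single 0 d + α) f

/-- The terms of degree less than `d` in `x₀` of a power series. -/
def lowPart (d : ℕ) (f : MvPowerSeries (Fin (m + 1)) ℂ) : MvPowerSeries (Fin (m + 1)) ℂ :=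
  fun α => if α 0 < d then coeff α f else 0

lemma coeff_shift (d : ℕ) (f : MvPowerSeries (Fin (m + 1)) ℂ) (α : Fin (m + 1) →₀ ℕ) :
    coeff α (shift d f) = coeff (Finsupp.single 0 d + α) f := rfl

lemma coeff_lowPart (d : ℕ) (f : MvPowerSeries (Fin (m + 1)) ℂ) (α : Fin (m + 1) →₀ ℕ) :
    coeff α (lowPart d f) = if α 0 < d then coeff α f else 0 := rfl

lemma monomial_mul_shift_add_lowPart (d : ℕ) (f : MvPowerSeries (Fin (m + 1)) ℂ) :
    MvPowerSeries.monomial (Finsupp.single 0 d) 1 * shift d f + lowPart d f = f := by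
  classical
  ext α
  rw [map_add, MvPowerSeries.coeff_monomial_mul, coeff_lowPart]
  by_cases h : d ≤ α 0
  · rw [if_pos (Finsupp.single_le_iff.2 h), if_neg (by omega), coeff_shift, one_mul, add_zero,
      add_tsub_cancel_of_le (Finsupp.single_le_iff.2 h)]
  · rw [if_neg (mt Finsupp.single_le_iff.1 h), if_pos (by omega), zero_add]

lemma wnorm_shift_le (w : Fin (m + 1) → ℝ≥0) (d : ℕ) (f : MvPowerSeries (Fin (m + 1)) ℂ) :
    (w 0 ^ d : ℝ≥0) * wnorm w (shift d f) ≤ wnorm w f := by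
  have hinj : Function.Injective fun α : Fin (m + 1) →₀ ℕ => Finsupp.single 0 d + α :=
    add_right_injective _
  refine le_trans (le_of_eq ?_) (ENNReal.tsum_comp_le_tsum_of_injective hinj _)
  rw [wnorm, ← ENNReal.tsum_mul_left]
  refine tsum_congr fun α => ?_
  rw [coeff_shift, mon_add, mon_single, ← ENNReal.coe_mul]
  congr 1
  ring

lemma Conv.lowPart {f : MvPowerSeries (Fin (m + 1)) ℂ} (hf : Conv f) (d : ℕ) :
    Conv (lowPart d f) :=
  hf.of_nnnorm_le fun α => by
    rw [coeff_lowPart]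
    split_ifs <;> simp

/-- For a series `δ` without terms `x₀^k` with `k ≤ d`, a polyradius that is much smaller in the
other variables than in `x₀` makes the norm of `δ` small compared with that of `x₀^d`. -/
lemma exists_weight_small {δ h : MvPowerSeries (Fin (m + 1)) ℂ} (hδ : Conv δ) (hh : Conv h) (d : ℕ)
    (h0 : ∀ k ≤ d, coeff (Finsupp.single 0 k) δ = 0) :
    ∃ w : Fin (m + 1) → ℝ≥0, (∀ i, 0 < w i) ∧ wnorm w h ≠ ∞ ∧
      2 * wnorm w δ ≤ (w 0 ^ d : ℝ≥0) := by
  obtain ⟨v, hv, hδv, hhv⟩ := exists_common_weight hδ hh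
  obtain ⟨N, hN⟩ : ∃ N : ℝ≥0, (N : ℝ≥0∞) = wnorm v δ := ⟨_, ENNReal.coe_toNNReal hδv⟩
  obtain ⟨t, ht0, ht1, ht⟩ : ∃ t : ℝ≥0, 0 < t ∧ t ≤ 1 ∧ 2 * (t * N) ≤ v 0 ^ d := by
    have h1 : Tendsto (fun t : ℝ≥0 => 2 * (t * N)) (𝓝[>] 0) (𝓝 (2 * (0 * N))) :=
      (Continuous.tendsto (by fun_prop) 0).mono_left nhdsWithin_le_nhds
    have h2 : ∀ᶠ t : ℝ≥0 in 𝓝[>] 0, 2 * (t * N) ≤ v 0 ^ d :=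
      h1.eventually (ge_mem_nhds (by simpa using pow_pos (hv 0) d))
    have h3 : ∀ᶠ t : ℝ≥0 in 𝓝[>] 0, t ≤ 1 :=
      mem_nhdsWithin_of_mem_nhds (ge_mem_nhds one_pos)
    obtain ⟨t, ⟨h2, h3⟩, h4⟩ := ((h2.and h3).and self_mem_nhdsWithin).exists
    exact ⟨t, h4, h3, h2⟩
  -- A monomial of `δ` has degree more than `d` in `x₀`, or it involves another variable; in both
  -- cases its weight gains a factor `t ^ (d + 1)`, while that of `x₀^d` gains only `t ^ d`.
  set w : Fin (m + 1) → ℝ≥0 := Fin.cons (t * v 0) fun i => t ^ (d + 1) * v i.succ with hw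
  have hw0 : w 0 = t * v 0 := rfl
  have hws (i : Fin m) : w i.succ = t ^ (d + 1) * v i.succ := rfl
  have hmon (α : Fin (m + 1) →₀ ℕ) :
      mon w α = t ^ (α 0 + (d + 1) * ∑ i : Fin m, α i.succ) * mon v α := by
    simp only [mon, Fin.prod_univ_succ, hw0, hws, mul_pow, Finset.prod_mul_distrib, ← pow_mul,
      Finset.prod_pow_eq_pow_sum, ← Finset.mul_sum, pow_add]
    ring
  refine ⟨w, fun i => ?_, ?_, ?_⟩
  · refine Fin.cases ?_ (fun i => ?_) i
    · rw [hw0]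
      exact mul_pos ht0 (hv 0)
    · rw [hws]
      exact mul_pos (pow_pos ht0 _) (hv _)
  · refine ne_top_of_le_ne_top hhv (wnorm_mono_weight (fun i => ?_) h)
    refine Fin.cases ?_ (fun i => ?_) i
    · rw [hw0]
      exact mul_le_of_le_one_left' ht1
    · rw [hws]
      exact mul_le_of_le_one_left' (pow_le_one' ht1 _)
  · have h1 : wnorm w δ ≤ (t ^ (d + 1) : ℝ≥0) * wnorm v δ := by
      rw [wnorm, wnorm, ← ENNReal.tsum_mul_left]
      refine ENNReal.tsum_le_tsum fun α => ?_
      rw [← ENNReal.coe_mul, ENNReal.coe_le_coe, hmon, mul_left_comm]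
      by_cases hα : coeff α δ = 0
      · simp [hα]
      gcongr ?_ * _
      refine pow_le_pow_right_of_le_one' ht1 ?_
      by_cases hs : ∑ i : Fin m, α i.succ = 0
      · by_contra! hlt
        refine hα ?_
        have hz : α = Finsupp.single 0 (α 0) := by
          ext i
          refine Fin.cases (by simp) (fun i => ?_) i
          simp [Finset.sum_eq_zero_iff.1 hs i (Finset.mem_univ i)]
        rw [hz]
        exact h0 _ (by omega)
      · have : d + 1 ≤ (d + 1) * ∑ i : Fin m, α i.succ :=
          Nat.le_mul_of_pos_right _ (Nat.pos_of_ne_zero hs)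
        omega
    refine (mul_le_mul_right h1 _).trans ?_
    rw [← hN, hw0, ← ENNReal.coe_mul, ← ENNReal.coe_ofNat, ← ENNReal.coe_mul, ENNReal.coe_le_coe]
    calc 2 * (t ^ (d + 1) * N) = t ^ d * (2 * (t * N)) := by ring
      _ ≤ t ^ d * v 0 ^ d := by gcongr
      _ = (t * v 0) ^ d := by rw [mul_pow]

/-- Completeness for the weighted norm: absolutely convergent sums exist, coefficient by
coefficient. -/
lemma exists_hasSum_coeff {w : Fin m → ℝ≥0} (hw : ∀ i, 0 < w i)
    {Q : ℕ → MvPowerSeries (Fin m) ℂ} (htot : ∑' k, wnorm w (Q k) ≠ ∞) :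
    ∃ q, Conv q ∧ ∀ α, HasSum (fun k => coeff α (Q k)) (coeff α q) := by
  have hsum (α : Fin m →₀ ℕ) : Summable fun k => coeff α (Q k) := by
    refine Summable.of_nnnorm ?_
    have h1 : ∑' k, ((‖coeff α (Q k)‖₊ * mon w α : ℝ≥0) : ℝ≥0∞) ≠ ∞ :=
      ne_top_of_le_ne_top htot (ENNReal.tsum_le_tsum fun k => ENNReal.le_tsum α)
    have h2 := (ENNReal.tsum_coe_ne_top_iff_summable.1 h1).mul_right (mon w α)⁻¹
    simpa only [mul_inv_cancel_right₀ (mon_pos hw α).ne'] using h2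
  refine ⟨fun α => ∑' k, coeff α (Q k), ⟨w, hw, ne_top_of_le_ne_top htot ?_⟩,
    fun α => (hsum α).hasSum⟩
  have h3 (α : Fin m →₀ ℕ) : ((‖∑' k, coeff α (Q k)‖₊ * mon w α : ℝ≥0) : ℝ≥0∞) ≤
      ∑' k, ((‖coeff α (Q k)‖₊ * mon w α : ℝ≥0) : ℝ≥0∞) := by
    simp only [ENNReal.coe_mul]
    rw [ENNReal.tsum_mul_right]
    gcongr
    exact enorm_tsum_le_tsum_enorm (f := fun k => coeff α (Q k))
  exact (ENNReal.tsum_le_tsum h3).trans_eq ENNReal.tsum_comm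

/-- Solution of the fixed-point equation behind the Weierstrass division theorem, by a geometric
series. -/
lemma exists_eq_shift_sub_mul {w : Fin (m + 1) → ℝ≥0} (hw : ∀ i, 0 < w i)
    {δ h : MvPowerSeries (Fin (m + 1)) ℂ} {d : ℕ} (hh : wnorm w h ≠ ∞)
    (hδ : 2 * wnorm w δ ≤ (w 0 ^ d : ℝ≥0)) : ∃ q, Conv q ∧ q = shift d (h - δ * q) := by
  classical
  obtain ⟨Q, hQ0, hQs⟩ : ∃ Q : ℕ → MvPowerSeries (Fin (m + 1)) ℂ, Q 0 = shift d h ∧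
      ∀ k, Q (k + 1) = shift d (-(δ * Q k)) :=
    ⟨fun k => Nat.rec (shift d h) (fun _ q => shift d (-(δ * q))) k, rfl, fun _ => rfl⟩
  have hr0 : ((w 0 ^ d : ℝ≥0) : ℝ≥0∞) ≠ 0 := by simpa using (pow_pos (hw 0) d).ne'
  have hshift {f : MvPowerSeries (Fin (m + 1)) ℂ} {b : ℝ≥0∞}
      (hf : wnorm w f ≤ (w 0 ^ d : ℝ≥0) * b) : wnorm w (shift d f) ≤ b :=
    (ENNReal.mul_le_mul_iff_right hr0 ENNReal.coe_ne_top).1 ((wnorm_shift_le w d f).trans hf)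
  have hhalf (k : ℕ) : wnorm w (Q (k + 1)) ≤ 2⁻¹ * wnorm w (Q k) := by
    rw [hQs]
    refine hshift ?_
    rw [wnorm_neg]
    refine (wnorm_mul_le w _ _).trans ?_
    rw [← mul_assoc]
    gcongr
    rw [← div_eq_mul_inv, ENNReal.le_div_iff_mul_le (by simp) (by simp), mul_comm]
    exact hδ
  have hgeom (k : ℕ) : wnorm w (Q k) ≤ 2⁻¹ ^ k * wnorm w (Q 0) := by
    induction k with
    | zero => simp
    | succ k ih =>
      refine (hhalf k).trans ?_
      rw [pow_succ', mul_assoc]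
      gcongr
  have hQ0top : wnorm w (Q 0) ≠ ∞ := by
    intro htop
    have := wnorm_shift_le w d h
    rw [← hQ0, htop, ENNReal.mul_top hr0, top_le_iff] at this
    exact hh this
  have htot : ∑' k, wnorm w (Q k) ≠ ∞ := by
    refine ne_top_of_le_ne_top ?_ (ENNReal.tsum_le_tsum hgeom)
    rw [ENNReal.tsum_mul_right, ENNReal.tsum_geometric]
    refine ENNReal.mul_ne_top ?_ hQ0top
    simp
  obtain ⟨q, hqc, hcq⟩ := exists_hasSum_coeff hw htot
  refine ⟨q, hqc, ?_⟩
  ext α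
  have hmul (β : Fin (m + 1) →₀ ℕ) :
      HasSum (fun k => coeff β (δ * Q k)) (coeff β (δ * q)) := by
    have h3 := hasSum_sum (s := Finset.HasAntidiagonal.antidiagonal β) fun p _ =>
      (hcq p.2).mul_left (coeff p.1 δ)
    rw [MvPowerSeries.coeff_mul]
    exact h3.congr_fun fun k => MvPowerSeries.coeff_mul _ _ _
  have h1 : HasSum (fun k => coeff α (Q (k + 1))) (-coeff (Finsupp.single 0 d + α) (δ * q)) := by
    simp only [hQs, coeff_shift, map_neg]
    exact (hmul _).neg
  have h2 : HasSum (fun k => coeff α (Q k))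
      (-coeff (Finsupp.single 0 d + α) (δ * q) + coeff α (Q 0)) := by
    simpa only [Finset.sum_range_one] using
      (hasSum_nat_add_iff (f := fun k => coeff α (Q k)) 1).1 h1
  have h4 : coeff α (shift d (h - δ * q)) = -coeff (Finsupp.single 0 d + α) (δ * q) +
      coeff α (Q 0) := by
    rw [hQ0, coeff_shift, coeff_shift, map_sub]
    ring
  rw [h4]
  exact (hcq α).unique h2

/-- Weierstrass division of convergent power series by a series that is regular of order `d` in
`x₀`. -/
theorem exists_conv_division {g h : MvPowerSeries (Fin (m + 1)) ℂ} (hg : Conv g) (hh : Conv h)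
    {d : ℕ} (hd : coeff (Finsupp.single 0 d) g ≠ 0)
    (hlt : ∀ k < d, coeff (Finsupp.single 0 k) g = 0) :
    ∃ q r, Conv q ∧ Conv r ∧ h = q * g + r ∧ ∀ α : Fin (m + 1) →₀ ℕ, d ≤ α 0 → coeff α r = 0 := by
  classical
  -- After division by the coefficient of `x₀^d`, the series is `g = x₀^d + δ`, and the quotient `q`
  -- by `g` satisfies `q = shift d (h - δ * q)`.
  set c := coeff (Finsupp.single 0 d) g with hc
  set Z : MvPowerSeries (Fin (m + 1)) ℂ := MvPowerSeries.monomial (Finsupp.single 0 d) 1 with hZ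
  have hcconv (a : ℂ) : Conv (MvPowerSeries.monomial (0 : Fin (m + 1) →₀ ℕ) a) :=
    conv_monomial 0 a
  set δ := MvPowerSeries.monomial 0 c⁻¹ * g - Z with hδ
  have hδc : Conv δ := by
    rw [hδ, sub_eq_add_neg]
    exact ((hcconv _).mul hg).add (conv_monomial _ _).neg
  have hδ0 : ∀ k ≤ d, coeff (Finsupp.single 0 k) δ = 0 := by
    intro k hk
    rw [hδ, map_sub, MvPowerSeries.coeff_monomial_mul, if_pos (zero_le), tsub_zero, hZ,
      MvPowerSeries.coeff_monomial]
    rcases hk.lt_or_eq with hk | rfl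
    · rw [hlt k hk, mul_zero, if_neg, sub_zero]
      intro h
      have := DFunLike.congr_fun h 0
      simp at this
      omega
    · rw [if_pos rfl, ← hc, inv_mul_cancel₀ hd, sub_self]
  obtain ⟨w, hw, hhw, hδw⟩ := exists_weight_small hδc hh d hδ0
  obtain ⟨q, hqc, hq⟩ := exists_eq_shift_sub_mul hw hhw hδw
  have hsub : Conv (h - δ * q) := by
    rw [sub_eq_add_neg]
    exact hh.add (hδc.mul hqc).neg
  refine ⟨MvPowerSeries.monomial 0 c⁻¹ * q, lowPart d (h - δ * q), (hcconv _).mul hqc,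
    hsub.lowPart d, ?_, fun α hα => ?_⟩
  · have h1 := monomial_mul_shift_add_lowPart d (h - δ * q)
    rw [← hq, ← hZ] at h1
    have h2 : MvPowerSeries.monomial 0 c⁻¹ * g = Z + δ := by rw [hδ]; ring
    calc h = (h - δ * q) + δ * q := by ring
      _ = (Z * q + lowPart d (h - δ * q)) + δ * q := by rw [h1]
      _ = (Z + δ) * q + lowPart d (h - δ * q) := by ring
      _ = _ := by rw [← h2]; ring
  · rw [coeff_lowPart, if_neg (by omega)]

end Division

/-! ### Weierstrass polynomials -/

section WeierstrassPolynomials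

open scoped ENNReal NNReal
open MvPowerSeries (coeff)
open Polynomial (C X)

variable {m n k : ℕ}

lemma rep_one : rep (1 : HolGerm n) =ᶠ[𝓝 0] 1 := rep_of (fun _ => 1) analyticAt_const

lemma analyticAt_comp_clm {F : (Fin k → ℂ) → ℂ} (hF : AnalyticAt ℂ F 0)
    (L : (Fin n → ℂ) →L[ℂ] (Fin k → ℂ)) : AnalyticAt ℂ (F ∘ L) 0 :=
  AnalyticAt.comp (by simpa using hF) (L.analyticAt 0)

/-- Pullback of germs along a linear map. -/
def pullback (L : (Fin n → ℂ) →L[ℂ] (Fin k → ℂ)) : HolGerm k →+* HolGerm n where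
  toFun g := HolGerm.of (rep g ∘ L) (analyticAt_comp_clm (analyticAt_rep g) L)
  map_one' := ext_of_rep (((rep_of _ _).trans (L.continuous.tendsto' 0 0 L.map_zero
    |>.eventually rep_one)).trans rep_one.symm)
  map_zero' := ext_of_rep (((rep_of _ _).trans (L.continuous.tendsto' 0 0 L.map_zero
    |>.eventually rep_zero)).trans rep_zero.symm)
  map_mul' g h := by
    have hL (g : HolGerm k) := analyticAt_comp_clm (analyticAt_rep g) L
    refine ext_of_rep ?_
    filter_upwards [L.continuous.tendsto' 0 0 L.map_zero |>.eventually (rep_mul g h),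
      rep_of _ (hL (g * h)), rep_of _ (hL g), rep_of _ (hL h),
      rep_mul (HolGerm.of _ (hL g)) (HolGerm.of _ (hL h))] with x h1 h2 h3 h4 h5
    rw [h5, h2, Pi.mul_apply, h3, h4, Function.comp_apply, h1]
    rfl
  map_add' g h := by
    have hL (g : HolGerm k) := analyticAt_comp_clm (analyticAt_rep g) L
    refine ext_of_rep ?_
    filter_upwards [L.continuous.tendsto' 0 0 L.map_zero |>.eventually (rep_add g h),
      rep_of _ (hL (g + h)), rep_of _ (hL g), rep_of _ (hL h),
      rep_add (HolGerm.of _ (hL g)) (HolGerm.of _ (hL h))] with x h1 h2 h3 h4 h5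
    rw [h5, h2, Pi.add_apply, h3, h4, Function.comp_apply, h1]
    rfl

lemma rep_pullback (L : (Fin n → ℂ) →L[ℂ] (Fin k → ℂ)) (g : HolGerm k) :
    rep (pullback L g) =ᶠ[𝓝 0] rep g ∘ L :=
  rep_of _ (analyticAt_comp_clm (analyticAt_rep g) L)

lemma pullback_pullback {l : ℕ} (L : (Fin n → ℂ) →L[ℂ] (Fin k → ℂ))
    (M : (Fin k → ℂ) →L[ℂ] (Fin l → ℂ)) (g : HolGerm l) :
    pullback L (pullback M g) = pullback (M.comp L) g := by
  refine ext_of_rep ?_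
  filter_upwards [rep_pullback L (pullback M g), rep_pullback (M.comp L) g,
    L.continuous.tendsto' 0 0 L.map_zero |>.eventually (rep_pullback M g)] with x h1 h2 h3
  rw [h1, h2, Function.comp_apply, h3]
  rfl

lemma pullback_id (g : HolGerm n) : pullback (ContinuousLinearMap.id ℂ _) g = g :=
  ext_of_rep (rep_pullback _ g)

lemma pullback_mem_germMaximalIdeal (L : (Fin n → ℂ) →L[ℂ] (Fin k → ℂ)) {g : HolGerm k} :
    pullback L g ∈ germMaximalIdeal n ↔ g ∈ germMaximalIdeal k := by
  rw [mem_germMaximalIdeal, mem_germMaximalIdeal, (rep_pullback L g).self_of_nhds,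
    Function.comp_apply, L.map_zero]

variable (m) in
/-- The projection along the coordinate `x₀`. -/
def tailMap : (Fin (m + 1) → ℂ) →L[ℂ] (Fin m → ℂ) :=
  ContinuousLinearMap.pi fun i => ContinuousLinearMap.proj i.succ

lemma tailMap_apply (x : Fin (m + 1) → ℂ) (i : Fin m) : tailMap m x i = x i.succ := rfl

lemma pullback_tailMap_coord (i : Fin m) : pullback (tailMap m) (coord i) = coord i.succ := by
  refine ext_of_rep ((rep_pullback _ _).trans ?_)
  filter_upwards [(tailMap m).continuous.tendsto' 0 0 (map_zero _)
    |>.eventually (rep_of (fun x : Fin m → ℂ => x i) (analyticAt_coord i 0)),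
    rep_of (fun x : Fin (m + 1) → ℂ => x i.succ) (analyticAt_coord i.succ 0)] with x h1 h2
  rw [Function.comp_apply, coord, h1, coord, h2]
  rfl

variable (m) in
/-- The ring of functions that are holomorphic near `0`. In contrast to germs, they can be evaluated
at points. -/
def analyticFunctions : Subring ((Fin m → ℂ) → ℂ) where
  carrier := {F | AnalyticAt ℂ F 0}
  zero_mem' := analyticAt_const
  one_mem' := analyticAt_const
  add_mem' := AnalyticAt.add
  mul_mem' := AnalyticAt.mul
  neg_mem' := AnalyticAt.neg

/-- The germ of a function that is holomorphic near `0`. -/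
def toGerm : analyticFunctions m →+* HolGerm m where
  toFun F := HolGerm.of F.1 F.2
  map_zero' := rfl
  map_one' := rfl
  map_add' _ _ := rfl
  map_mul' _ _ := rfl

lemma rep_toGerm (F : analyticFunctions m) : rep (toGerm F) =ᶠ[𝓝 0] F.1 := rep_of _ F.2

/-- Evaluation at a point. -/
def evalAt (x : Fin m → ℂ) : analyticFunctions m →+* ℂ :=
  (Pi.evalRingHom _ x).comp (analyticFunctions m).subtype

lemma evalAt_apply (x : Fin m → ℂ) (F : analyticFunctions m) : evalAt x F = F.1 x := rfl

/-- The function defined by a polynomial in `x₀` whose coefficients are functions of the other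
variables. -/
def polyFun (P : Polynomial (analyticFunctions m)) (x : Fin (m + 1) → ℂ) : ℂ :=
  (P.map (evalAt (tailMap m x))).eval (x 0)

lemma analyticAt_polyFun (P : Polynomial (analyticFunctions m)) :
    AnalyticAt ℂ (polyFun P) 0 := by
  induction P using Polynomial.induction_on' with
  | add p q hp hq =>
    have : polyFun (p + q) = polyFun p + polyFun q := by
      ext x
      simp [polyFun]
    rw [this]
    exact hp.add hq
  | monomial k a =>
    have : polyFun (Polynomial.monomial k a) = fun x => a.1 (tailMap m x) * x 0 ^ k := by
      ext x
      simp [polyFun, evalAt_apply]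
    rw [this]
    exact (analyticAt_comp_clm a.2 (tailMap m)).mul
      ((analyticAt_coord 0 0).pow k)

/-- The germ defined by a polynomial in `x₀` whose coefficients are functions of the other
variables. -/
def polyGerm : Polynomial (analyticFunctions m) →+* HolGerm (m + 1) where
  toFun P := HolGerm.of (polyFun P) (analyticAt_polyFun P)
  map_zero' := of_eq_of _ analyticAt_const (Eventually.of_forall fun x => by simp [polyFun])
  map_one' := of_eq_of _ analyticAt_const (Eventually.of_forall fun x => by simp [polyFun])
  map_add' P Q := of_eq_of _ ((analyticAt_polyFun P).add (analyticAt_polyFun Q))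
    (Eventually.of_forall fun x => by simp [polyFun])
  map_mul' P Q := of_eq_of _ ((analyticAt_polyFun P).mul (analyticAt_polyFun Q))
    (Eventually.of_forall fun x => by simp [polyFun])

lemma rep_polyGerm (P : Polynomial (analyticFunctions m)) :
    rep (polyGerm P) =ᶠ[𝓝 0] polyFun P := rep_of _ (analyticAt_polyFun P)

lemma polyGerm_C (a : analyticFunctions m) : polyGerm (C a) = pullback (tailMap m) (toGerm a) := by
  refine ext_of_rep ((rep_polyGerm _).trans ?_)
  filter_upwards [rep_pullback (tailMap m) (toGerm a), (tailMap m).continuous.tendsto' 0 0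
    (map_zero _) |>.eventually (rep_toGerm a)] with x h1 h2
  rw [h1, Function.comp_apply, h2]
  simp [polyFun, evalAt_apply]

lemma polyGerm_X : polyGerm (X : Polynomial (analyticFunctions m)) = coord 0 :=
  of_eq_of (analyticAt_polyFun X) _ (Eventually.of_forall fun x => by simp [polyFun])

/-- The polynomial `∑_{k < d} a_k X^k`. -/
def lowPoly {d : ℕ} (a : Fin d → analyticFunctions m) : Polynomial (analyticFunctions m) :=
  ∑ k : Fin d, C (a k) * X ^ (k : ℕ)

lemma polyFun_lowPoly {d : ℕ} (a : Fin d → analyticFunctions m) (x : Fin (m + 1) → ℂ) :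
    polyFun (lowPoly a) x = ∑ k : Fin d, (a k).1 (tailMap m x) * x 0 ^ (k : ℕ) := by
  simp [polyFun, lowPoly, Polynomial.map_sum, Polynomial.eval_finsetSum, evalAt_apply]

lemma mon_cons (j : ℕ) (β : Fin m →₀ ℕ) (x : Fin (m + 1) → ℂ) :
    mon x (Finsupp.cons j β) = x 0 ^ j * mon (tailMap m x) β := by
  simp [mon, Fin.prod_univ_succ, tailMap_apply]

/-- The coefficient of `x₀^j` in a power series. -/
def coeffX (j : ℕ) (r : MvPowerSeries (Fin (m + 1)) ℂ) : MvPowerSeries (Fin m) ℂ :=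
  fun β => coeff (Finsupp.cons j β) r

lemma coeff_coeffX (j : ℕ) (r : MvPowerSeries (Fin (m + 1)) ℂ) (β : Fin m →₀ ℕ) :
    coeff β (coeffX j r) = coeff (Finsupp.cons j β) r := rfl

lemma Conv.coeffX {r : MvPowerSeries (Fin (m + 1)) ℂ} (hr : Conv r) (j : ℕ) :
    Conv (coeffX j r) := by
  obtain ⟨w, hw, hr⟩ := hr
  refine ⟨fun i => w i.succ, fun i => hw _, fun htop => hr ?_⟩
  have h1 : (w 0 ^ j : ℝ≥0) * wnorm (fun i => w i.succ) (BruceRoberts.coeffX j r) ≤ wnorm w r := by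
    refine le_trans (le_of_eq ?_)
      (ENNReal.tsum_comp_le_tsum_of_injective (Finsupp.cons_right_injective j) _)
    rw [wnorm, ← ENNReal.tsum_mul_left]
    refine tsum_congr fun β => ?_
    rw [← ENNReal.coe_mul, coeff_coeffX]
    congr 1
    simp only [mon, Fin.prod_univ_succ, Finsupp.cons_zero, Finsupp.cons_succ]
    ring
  rwa [htop, ENNReal.mul_top (by simpa using (pow_pos (hw 0) j).ne'), top_le_iff] at h1

/-- An exponent of a monomial, split into the exponent of `x₀` and the others. -/
def exponentEquiv (m : ℕ) : ℕ × (Fin m →₀ ℕ) ≃ (Fin (m + 1) →₀ ℕ) where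
  toFun p := Finsupp.cons p.1 p.2
  invFun α := (α 0, α.tail)
  left_inv p := by simp
  right_inv α := by simp

lemma exponentEquiv_apply (j : ℕ) (β : Fin m →₀ ℕ) :
    exponentEquiv m (j, β) = Finsupp.cons j β := rfl

lemma ev_eq_sum_coeffX {w : Fin (m + 1) → ℝ≥0} {r : MvPowerSeries (Fin (m + 1)) ℂ}
    (hr : wnorm w r ≠ ∞) {x : Fin (m + 1) → ℂ} (hx : ∀ i, ‖x i‖₊ ≤ w i) {d : ℕ}
    (hd : ∀ α : Fin (m + 1) →₀ ℕ, d ≤ α 0 → coeff α r = 0) :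
    ev r x = ∑ k : Fin d, ev (coeffX k r) (tailMap m x) * x 0 ^ (k : ℕ) := by
  have hs : Summable fun p => coeff (exponentEquiv m p) r * mon x (exponentEquiv m p) :=
    (summable_of_le_weight hr hx).comp_injective (exponentEquiv m).injective
  have h1 : ev r x = ∑' p, coeff (exponentEquiv m p) r * mon x (exponentEquiv m p) :=
    ((exponentEquiv m).tsum_eq fun α => coeff α r * mon x α).symm
  have h2 (j : ℕ) : ∑' β, coeff (exponentEquiv m (j, β)) r * mon x (exponentEquiv m (j, β)) =
      ev (coeffX j r) (tailMap m x) * x 0 ^ j := by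
    rw [ev, ← tsum_mul_right]
    refine tsum_congr fun β => ?_
    rw [exponentEquiv_apply, mon_cons, coeff_coeffX]
    ring
  have h3 : ∀ j ∉ Finset.range d, ev (coeffX j r) (tailMap m x) * x 0 ^ j = 0 := by
    intro j hj
    have : coeffX j r = 0 := by
      ext β
      rw [coeff_coeffX, hd _ (by simpa using hj), map_zero]
    rw [this]
    simp [ev]
  rw [h1, hs.tsum_prod, tsum_congr h2, tsum_eq_sum h3, Finset.sum_range]

/-- A convergent power series of degree less than `d` in `x₀` is a polynomial in `x₀` with
convergent coefficients. -/
lemma exists_taylor_polyGerm_eq {r : MvPowerSeries (Fin (m + 1)) ℂ} (hr : Conv r) {d : ℕ}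
    (hd : ∀ α : Fin (m + 1) →₀ ℕ, d ≤ α 0 → coeff α r = 0) :
    ∃ a : Fin d → analyticFunctions m, taylor (polyGerm (lowPoly a)) = r ∧
      ∀ k : Fin d, (a k).1 0 = coeff (Finsupp.single 0 (k : ℕ)) r := by
  obtain ⟨a, ha⟩ : ∃ a : Fin d → analyticFunctions m, ∀ k : Fin d, (a k).1 = ev (coeffX k r) :=
    ⟨fun k => ⟨ev (coeffX k r), (hr.coeffX k).analyticAt_ev⟩, fun _ => rfl⟩
  refine ⟨a, taylor_eq hr ?_, fun k => ?_⟩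
  · obtain ⟨w, hw, hrw⟩ := id hr
    filter_upwards [eventually_le_weight hw, rep_polyGerm (lowPoly a)] with x hx h1
    rw [h1, polyFun_lowPoly]
    simp only [ha]
    exact ev_eq_sum_coeffX hrw hx hd
  · rw [ha, ev_zero_right, coeff_coeffX, Finsupp.cons_zero_eq_single_zero]

/-- A germ is regular of order `d` in `x₀` if its restriction to the `x₀`-axis has a zero of order
`d`. -/
def IsRegular (d : ℕ) (g : HolGerm (m + 1)) : Prop :=
  coeff (Finsupp.single 0 d) (taylor g) ≠ 0 ∧
    ∀ k < d, coeff (Finsupp.single 0 k) (taylor g) = 0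

/-- Weierstrass division. -/
lemma IsRegular.exists_division {d : ℕ} {g : HolGerm (m + 1)} (hg : IsRegular d g)
    (h : HolGerm (m + 1)) : ∃ (q : HolGerm (m + 1)) (a : Fin d → analyticFunctions m),
      h = q * g + polyGerm (lowPoly a) := by
  obtain ⟨q, r, hq, hr, e, hd⟩ := exists_conv_division (conv_taylor g) (conv_taylor h) hg.1 hg.2
  obtain ⟨q, rfl⟩ := exists_taylor_eq hq
  obtain ⟨a, rfl, -⟩ := exists_taylor_polyGerm_eq hr hd
  exact ⟨q, a, taylor_injective (by rw [e, taylor_add, taylor_mul])⟩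

lemma taylor_one : taylor (1 : HolGerm n) = 1 := by
  refine taylor_eq (conv_monomial 0 1) ?_
  filter_upwards [rep_one (n := n)] with x hx
  have h1 := ev_monomial (0 : Fin n →₀ ℕ) 1 x
  rw [mon_zero, mul_one] at h1
  rw [hx]
  exact h1

lemma taylor_coord_pow (i : Fin n) (d : ℕ) : taylor (coord i ^ d) = MvPowerSeries.X i ^ d := by
  induction d with
  | zero => rw [pow_zero, pow_zero, taylor_one]
  | succ d ih => rw [pow_succ, taylor_mul, ih, taylor_coord, pow_succ]

/-- Weierstrass preparation: up to a unit, a germ that is regular of order `d` is a monic polynomial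
in `x₀` of degree `d` whose other coefficients vanish at `0`. -/
lemma IsRegular.exists_preparation {d : ℕ} {g : HolGerm (m + 1)} (hg : IsRegular d g) :
    ∃ (q : HolGerm (m + 1)) (a : Fin d → analyticFunctions m), rep q 0 ≠ 0 ∧
      (∀ k, (a k).1 0 = 0) ∧ polyGerm (X ^ d - lowPoly a) = q * g := by
  classical
  obtain ⟨q, r, hq, hr, e, hd⟩ :=
    exists_conv_division (conv_taylor g) (conv_taylor (coord 0 ^ d)) hg.1 hg.2
  obtain ⟨q, rfl⟩ := exists_taylor_eq hq
  obtain ⟨a, rfl, ha⟩ := exists_taylor_polyGerm_eq hr hd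
  -- The coefficients of the powers of `x₀` in the product `q * g`.
  have hlow (k : ℕ) (hk : k < d) : coeff (Finsupp.single 0 k) (taylor q * taylor g) = 0 := by
    rw [MvPowerSeries.coeff_mul, Finsupp.antidiagonal_single, Finset.sum_map]
    refine Finset.sum_eq_zero fun p hp => ?_
    have hp := Finset.HasAntidiagonal.mem_antidiagonal.1 hp
    exact mul_eq_zero_of_right _ (hg.2 p.2 (by omega))
  have htop : coeff (Finsupp.single 0 d) (taylor q * taylor g) =
      coeff 0 (taylor q) * coeff (Finsupp.single 0 d) (taylor g) := by
    rw [MvPowerSeries.coeff_mul, Finsupp.antidiagonal_single, Finset.sum_map,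
      Finset.sum_eq_single (0, d)]
    · simp
    · intro p hp hne
      have hp := Finset.HasAntidiagonal.mem_antidiagonal.1 hp
      have h2 : p.2 ≠ d := fun h => hne (Prod.ext (by omega) h)
      exact mul_eq_zero_of_right _ (hg.2 p.2 (by omega))
    · intro h
      exact absurd (Finset.HasAntidiagonal.mem_antidiagonal.2 (zero_add d)) h
  rw [taylor_coord_pow] at e
  refine ⟨q, a, ?_, fun k => ?_, ?_⟩
  · have h1 := congrArg (coeff (Finsupp.single 0 d)) e
    rw [map_add, htop, hd _ (by simp), add_zero, MvPowerSeries.coeff_X_pow, if_pos rfl] at h1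
    rw [← coeff_zero_taylor]
    exact left_ne_zero_of_mul (h1 ▸ one_ne_zero)
  · have h1 := congrArg (coeff (Finsupp.single 0 (k : ℕ))) e
    rw [map_add, hlow k k.2, zero_add, MvPowerSeries.coeff_X_pow, if_neg] at h1
    · rw [ha, ← h1]
    · intro h
      have := DFunLike.congr_fun h 0
      simp at this
      omega
  · rw [map_sub, map_pow, polyGerm_X, sub_eq_iff_eq_add]
    exact taylor_injective (by rw [taylor_coord_pow, e, taylor_add, taylor_mul])

end WeierstrassPolynomials

/-! ### The local Nullstellensatz for an isolated zero -/

section Nullstellensatz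

open MvPowerSeries (coeff)
open Polynomial (C X)

variable {m n : ℕ}

/-- A nonzero germ does not vanish on some line through `0`. -/
lemma exists_not_eventually_smul {g : HolGerm n} (hg : g ≠ 0) :
    ∃ v : Fin n → ℂ, ¬ ∀ᶠ t in 𝓝 (0 : ℂ), rep g (t • v) = 0 := by
  by_contra! H
  obtain ⟨r, hr, hball⟩ :=
    Metric.eventually_nhds_iff_ball.1 (analyticAt_rep g).eventually_analyticAt
  refine hg (ext_of_rep (EventuallyEq.trans ?_ rep_zero.symm))
  filter_upwards [Metric.ball_mem_nhds 0 hr] with v hv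
  let ℓ : ℂ →L[ℂ] (Fin n → ℂ) := ContinuousLinearMap.toSpanSingleton ℂ v
  have hℓ (t : ℂ) : ℓ t = t • v := ContinuousLinearMap.toSpanSingleton_apply ..
  have hconv : Convex ℝ (ℓ ⁻¹' Metric.ball 0 r) :=
    (convex_ball 0 r).linear_preimage (ℓ.toLinearMap.restrictScalars ℝ)
  have hana : AnalyticOnNhd ℂ (rep g ∘ ℓ) (ℓ ⁻¹' Metric.ball 0 r) := fun t ht =>
    (hball _ ht).comp (ℓ.analyticAt t)
  have h0 : (0 : ℂ) ∈ ℓ ⁻¹' Metric.ball 0 r := by simpa using hr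
  have h1 : (1 : ℂ) ∈ ℓ ⁻¹' Metric.ball 0 r := by simpa [hℓ] using hv
  have := hana.eqOn_zero_of_preconnected_of_eventuallyEq_zero hconv.isPreconnected h0
    ((H v).mono fun t ht => by simpa [hℓ] using ht) h1
  simpa [hℓ] using this

lemma exists_isRegular {g : HolGerm (m + 1)}
    (hg : ¬ ∀ᶠ t in 𝓝 (0 : ℂ), rep g (t • Pi.single 0 1) = 0) : ∃ d, IsRegular d g := by
  classical
  by_cases H : ∃ d, coeff (Finsupp.single 0 d) (taylor g) ≠ 0
  · exact ⟨Nat.find H, Nat.find_spec H, fun k hk => not_not.1 (Nat.find_min H hk)⟩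
  push Not at H
  refine absurd ?_ hg
  have h1 : Tendsto (fun t : ℂ => t • (Pi.single 0 1 : Fin (m + 1) → ℂ)) (𝓝 0) (𝓝 0) :=
    Continuous.tendsto' (by fun_prop) _ _ (zero_smul _ _)
  filter_upwards [h1.eventually (ev_taylor g)] with t ht
  rw [← ht, ev]
  refine (tsum_congr fun α => ?_).trans tsum_zero
  by_cases hα : α = Finsupp.single 0 (α 0)
  · rw [hα, H, zero_mul]
  · obtain ⟨i, hi⟩ : ∃ i : Fin m, α i.succ ≠ 0 := by
      by_contra! hz
      refine hα (Finsupp.ext fun i => ?_)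
      refine Fin.cases (by simp) (fun i => ?_) i
      simp [hz i]
    refine mul_eq_zero_of_right _ (Finset.prod_eq_zero (Finset.mem_univ i.succ) ?_)
    simp [hi]

/-- A nonzero germ becomes regular in `x₀` after a linear change of coordinates. -/
lemma exists_isRegular_pullback {g : HolGerm (m + 1)} (hg : g ≠ 0) (h0 : rep g 0 = 0) :
    ∃ (L : (Fin (m + 1) → ℂ) ≃L[ℂ] (Fin (m + 1) → ℂ)) (d : ℕ),
      IsRegular d (pullback (L : (Fin (m + 1) → ℂ) →L[ℂ] (Fin (m + 1) → ℂ)) g) := by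
  obtain ⟨v, hv⟩ := exists_not_eventually_smul hg
  have hv0 : v ≠ 0 := by
    rintro rfl
    exact hv (by simp [h0])
  have he : (Pi.single 0 1 : Fin (m + 1) → ℂ) ≠ 0 := by
    intro h
    simpa using congrFun h 0
  obtain ⟨L, hL⟩ := SeparatingDual.exists_continuousLinearEquiv_apply_eq (R := ℂ) he hv0
  refine ⟨L, exists_isRegular fun H => hv ?_⟩
  have h1 : Tendsto (fun t : ℂ => t • (Pi.single 0 1 : Fin (m + 1) → ℂ)) (𝓝 0) (𝓝 0) :=
    Continuous.tendsto' (by fun_prop) _ _ (zero_smul _ _)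
  filter_upwards [H, h1.eventually (rep_pullback (L : (Fin (m + 1) → ℂ) →L[ℂ] _) g)] with t h2 h3
  rw [h3] at h2
  simpa [hL] using h2

/-- The roots of a Weierstrass polynomial are small. -/
lemma eventually_forall_root_mem {d : ℕ} {a : Fin d → analyticFunctions m}
    (ha : ∀ k, (a k).1 0 = 0) {U : Set (Fin (m + 1) → ℂ)} (hU : U ∈ 𝓝 0) :
    ∀ᶠ y in 𝓝 (0 : Fin m → ℂ), ∀ t : ℂ, t ^ d = ∑ k : Fin d, (a k).1 y * t ^ (k : ℕ) →
      (Fin.cons t y : Fin (m + 1) → ℂ) ∈ U := by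
  obtain ⟨ε, hε, hball⟩ := Metric.mem_nhds_iff.1 hU
  have hS : ∀ᶠ y in 𝓝 (0 : Fin m → ℂ), ∑ k : Fin d, ‖(a k).1 y‖ * (ε⁻¹) ^ (d - k : ℕ) < 1 := by
    have hc : ContinuousAt (fun y : Fin m → ℂ =>
        ∑ k : Fin d, ‖(a k).1 y‖ * (ε⁻¹) ^ (d - k : ℕ)) 0 :=
      tendsto_finsetSum _ fun k _ =>
        (((show AnalyticAt ℂ (a k).1 0 from (a k).2).continuousAt.norm).mul continuousAt_const)
    refine hc.eventually (gt_mem_nhds ?_)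
    simp [ha]
  filter_upwards [hS, Metric.ball_mem_nhds 0 hε] with y hy hyε t ht
  refine hball ?_
  rw [mem_ball_zero_iff, pi_norm_lt_iff hε]
  intro i
  refine Fin.cases ?_ (fun i => ?_) i
  · rw [Fin.cons_zero]
    by_contra! hle
    have ht0 : 0 < ‖t‖ := hε.trans_le hle
    refine lt_irrefl (‖t‖ ^ d) ?_
    calc ‖t‖ ^ d = ‖∑ k : Fin d, (a k).1 y * t ^ (k : ℕ)‖ := by rw [← norm_pow, ht]
      _ ≤ ∑ k : Fin d, ‖(a k).1 y‖ * ‖t‖ ^ (k : ℕ) := (norm_sum_le _ _).trans (by simp)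
      _ ≤ ∑ k : Fin d, ‖(a k).1 y‖ * ((ε⁻¹) ^ (d - k : ℕ) * ‖t‖ ^ d) := by
          gcongr with k
          have : ‖t‖ ^ d = ‖t‖ ^ (d - k : ℕ) * ‖t‖ ^ (k : ℕ) := by
            rw [← pow_add, Nat.sub_add_cancel k.2.le]
          rw [this, ← mul_assoc, ← mul_pow]
          refine le_mul_of_one_le_left (by positivity) (one_le_pow₀ ?_)
          rwa [← div_eq_inv_mul, one_le_div hε]
      _ = (∑ k : Fin d, ‖(a k).1 y‖ * (ε⁻¹) ^ (d - k : ℕ)) * ‖t‖ ^ d := by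
          rw [Finset.sum_mul]
          exact Finset.sum_congr rfl fun k _ => by ring
      _ < 1 * ‖t‖ ^ d := by gcongr
      _ = ‖t‖ ^ d := one_mul _
  · rw [Fin.cons_succ]
    exact (norm_le_pi_norm y i).trans_lt (mem_ball_zero_iff.1 hyε)

/-- If sufficiently many members of the pencil spanned by the `c j` have a zero in `S`, then the
`c j` have a common zero in `S`. -/
lemma exists_forall_eq_zero_of_prod_eq_zero {r : ℕ} (S : Multiset ℂ) (c : Fin r → ℂ → ℂ)
    (h : ∀ s : ℕ, s ≤ Multiset.card S * r →
      (S.map fun t => ∑ j : Fin r, (s : ℂ) ^ (j : ℕ) * c j t).prod = 0) :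
    ∃ t ∈ S, ∀ j, c j t = 0 := by
  -- The product over `S`, as a polynomial in the parameter of the pencil, has too many zeros.
  set p : ℂ → Polynomial ℂ := fun t => ∑ j : Fin r, C (c j t) * X ^ (j : ℕ) with hp
  have hdeg (t : ℂ) : (p t).natDegree ≤ r :=
    Polynomial.natDegree_sum_le_of_forall_le _ _ fun j _ =>
      (Polynomial.natDegree_C_mul_X_pow_le _ _).trans j.2.le
  have hev (s : ℂ) : (S.map p).prod.eval s =
      (S.map fun t => ∑ j : Fin r, s ^ (j : ℕ) * c j t).prod := by
    rw [Polynomial.eval_multiset_prod, Multiset.map_map]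
    congr 1
    refine Multiset.map_congr rfl fun t _ => ?_
    rw [Function.comp_apply, hp, Polynomial.eval_finsetSum]
    refine Finset.sum_congr rfl fun j _ => ?_
    rw [Polynomial.eval_mul, Polynomial.eval_C, Polynomial.eval_pow, Polynomial.eval_X, mul_comm]
  have hzero : (S.map p).prod = 0 := by
    refine Polynomial.eq_zero_of_natDegree_lt_card_of_eval_eq_zero' _
      ((Finset.range (Multiset.card S * r + 1)).map Nat.castEmbedding) ?_ ?_
    · intro x hx
      obtain ⟨s, hs, rfl⟩ := Finset.mem_map.1 hx
      rw [Nat.castEmbedding_apply, hev]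
      exact h s (by simpa [Nat.lt_succ_iff] using hs)
    · rw [Finset.card_map, Finset.card_range, Nat.lt_succ_iff]
      refine (Polynomial.natDegree_multiset_prod_le _).trans ?_
      refine (Multiset.sum_le_card_nsmul _ r ?_).trans (by simp)
      intro x hx
      obtain ⟨q, hq, rfl⟩ := Multiset.mem_map.1 hx
      obtain ⟨t, -, rfl⟩ := Multiset.mem_map.1 hq
      exact hdeg t
  obtain ⟨t, ht, h0⟩ := Multiset.mem_map.1 (Multiset.prod_eq_zero_iff.1 hzero)
  refine ⟨t, ht, fun j => ?_⟩
  have := congrArg (fun q => Polynomial.coeff q (j : ℕ)) h0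
  simpa only [hp, Polynomial.finsetSum_coeff, Polynomial.coeff_C_mul_X_pow, Fin.val_inj,
    Finset.sum_ite_eq, Finset.mem_univ, if_true, Polynomial.coeff_zero] using this

/-- The inductive step of the Nullstellensatz: the common zeros are projected along `x₀`, by means
of resultants. -/
lemma germMaximalIdeal_le_radical_of_isRegular
    (ih : ∀ {r : ℕ} (g : Fin r → HolGerm m), (∀ᶠ x in 𝓝 0, (∀ j, rep (g j) x = 0) → x = 0) →
      germMaximalIdeal m ≤ (Ideal.span (Set.range g)).radical)
    {r : ℕ} (g : Fin r → HolGerm (m + 1))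
    (hg : ∀ᶠ x in 𝓝 0, (∀ j, rep (g j) x = 0) → x = 0) {d : ℕ} (hd : d ≠ 0) {j₀ : Fin r}
    (hreg : IsRegular d (g j₀)) :
    germMaximalIdeal (m + 1) ≤ (Ideal.span (Set.range g)).radical := by
  set I := Ideal.span (Set.range g) with hI
  have hgI (j : Fin r) : g j ∈ I := Ideal.subset_span ⟨j, rfl⟩
  obtain ⟨q₀, w, hq₀, hw, hW⟩ := hreg.exists_preparation
  choose q a hqa using fun j => hreg.exists_division (g j)
  have hlow {d : ℕ} (a : Fin d → analyticFunctions m) : (lowPoly a).degree < d :=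
    Polynomial.degree_sum_fin_lt a
  set W : Polynomial (analyticFunctions m) := X ^ d - lowPoly w with hWdef
  have hWmonic : W.Monic := Polynomial.monic_X_pow_sub (hlow w)
  have hWdeg' : W.natDegree = d := by
    refine Polynomial.natDegree_eq_of_degree_eq_some ?_
    rw [hWdef, Polynomial.degree_sub_eq_left_of_degree_lt, Polynomial.degree_X_pow]
    rw [Polynomial.degree_X_pow]
    exact hlow w
  have hWdeg (y : Fin m → ℂ) : (W.map (evalAt y)).natDegree = d := by
    rw [hWmonic.natDegree_map, hWdeg']
  -- The resultants of `W` with sufficiently many combinations of the remainders detect the points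
  -- below the common zeros.
  set H : ℕ → Polynomial (analyticFunctions m) :=
    fun s => ∑ j : Fin r, C ((s : analyticFunctions m) ^ (j : ℕ)) * lowPoly (a j) with hH
  have hHdeg (s : ℕ) : (H s).natDegree ≤ d :=
    Polynomial.natDegree_sum_le_of_forall_le _ _ fun j _ =>
      (Polynomial.natDegree_C_mul_le _ _).trans
        (Polynomial.natDegree_le_of_degree_le (hlow (a j)).le)
  have hWI : polyGerm W ∈ I := hW ▸ I.mul_mem_left _ (hgI j₀)
  have haI (j : Fin r) : polyGerm (lowPoly (a j)) ∈ I := by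
    rw [← sub_eq_iff_eq_add'.2 (hqa j)]
    exact sub_mem (hgI j) (I.mul_mem_left _ (hgI j₀))
  have hHI (s : ℕ) : polyGerm (H s) ∈ I := by
    rw [hH, map_sum]
    exact sum_mem fun j _ => by rw [map_mul]; exact I.mul_mem_left _ (haI j)
  set R : ℕ → analyticFunctions m := fun s => Polynomial.resultant W (H s) d d with hR
  have hRI (s : ℕ) : pullback (tailMap m) (toGerm (R s)) ∈ I := by
    obtain ⟨p, p', -, -, e⟩ := Polynomial.exists_mul_add_mul_eq_C_resultant W (H s)
      hWdeg'.le (hHdeg s) (Or.inl hd)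
    rw [← polyGerm_C, hR, ← e, map_add, map_mul, map_mul]
    exact add_mem (I.mul_mem_right _ hWI) (I.mul_mem_right _ (hHI s))
  have hRzero : ∀ᶠ y in 𝓝 (0 : Fin m → ℂ),
      (∀ s : Fin (d * r + 1), rep (toGerm (R s)) y = 0) → y = 0 := by
    have hU : ∀ᶠ x in 𝓝 (0 : Fin (m + 1) → ℂ), ((∀ j, rep (g j) x = 0) → x = 0) ∧
        (∀ j, rep (g j) x = rep (q j) x * rep (g j₀) x + polyFun (lowPoly (a j)) x) ∧
        polyFun W x = rep q₀ x * rep (g j₀) x ∧ rep q₀ x ≠ 0 := by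
      refine hg.and (Eventually.and (eventually_all.2 fun j => ?_) (Eventually.and ?_ ?_))
      · filter_upwards [rep_add (q j * g j₀) (polyGerm (lowPoly (a j))), rep_mul (q j) (g j₀),
          rep_polyGerm (lowPoly (a j))] with x h1 h2 h3
        conv_lhs => rw [hqa j]
        rw [h1, Pi.add_apply, h2, h3, Pi.mul_apply]
      · filter_upwards [rep_polyGerm W, rep_mul q₀ (g j₀)] with x h1 h2
        rw [← h1, hW, h2, Pi.mul_apply]
      · exact (analyticAt_rep q₀).continuousAt.eventually_ne hq₀
    -- At a point `y` where all resultants vanish, some root `t` of `W` is a common zero of the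
    -- remainders, so that `(t, y)` is a common zero of the germs. The root is small as `y` is
    -- small.
    filter_upwards [eventually_forall_root_mem hw hU,
      eventually_all.2 fun s : Fin (d * r + 1) => rep_toGerm (R s)] with y h1 h2 h3
    have hy (t : ℂ) : tailMap m (Fin.cons t y) = y := by
      ext i
      rw [tailMap_apply, Fin.cons_succ]
    have hfun (P : Polynomial (analyticFunctions m)) (t : ℂ) :
        polyFun P (Fin.cons t y) = (P.map (evalAt y)).eval t := by
      rw [polyFun, hy, Fin.cons_zero]
    obtain ⟨t, ht, h4⟩ := exists_forall_eq_zero_of_prod_eq_zero (W.map (evalAt y)).roots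
      (fun j t => ((lowPoly (a j)).map (evalAt y)).eval t) (fun s hs => by
        have hs' : s < d * r + 1 := by
          have := Polynomial.card_roots' (W.map (evalAt y))
          rw [hWdeg] at this
          exact Nat.lt_succ_of_le (hs.trans (Nat.mul_le_mul_right r this))
        have h5 := h3 ⟨s, hs'⟩
        rw [h2 ⟨s, hs'⟩, ← evalAt_apply, hR, ← Polynomial.resultant_map_map] at h5
        have h6 := Polynomial.resultant_eq_prod_eval (W.map (evalAt y)) ((H s).map (evalAt y)) d
          (Polynomial.natDegree_map_le.trans (hHdeg s)) (IsAlgClosed.splits _)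
        rw [hWdeg, (hWmonic.map _).leadingCoeff, one_pow, one_mul] at h6
        rw [h6] at h5
        rw [← h5]
        congr 1
        refine Multiset.map_congr rfl fun t _ => ?_
        simp [hH, Polynomial.map_sum, Polynomial.eval_finsetSum])
    have h5 : (W.map (evalAt y)).eval t = 0 := (Polynomial.mem_roots'.1 ht).2
    obtain ⟨h6, h7, h8, h9⟩ := h1 t (by
      rw [hWdef, Polynomial.map_sub, Polynomial.eval_sub, sub_eq_zero] at h5
      have h6 := polyFun_lowPoly w (Fin.cons t y)
      rw [hfun, hy, Fin.cons_zero] at h6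
      rw [← h6, ← h5]
      simp)
    rw [hfun, h5, eq_comm] at h8
    have h10 := (mul_eq_zero.1 h8).resolve_left h9
    have h11 := h6 fun j => by rw [h7, h10, mul_zero, zero_add, hfun, h4 j]
    rw [← hy t, h11, map_zero]
  have hrad : germMaximalIdeal m ≤ I.radical.comap (pullback (tailMap m)) := by
    refine (ih (fun s : Fin (d * r + 1) => toGerm (R s)) hRzero).trans ?_
    rw [Ideal.comap_radical]
    refine Ideal.radical_mono (Ideal.span_le.2 ?_)
    rintro _ ⟨s, rfl⟩
    exact hRI s
  rw [germMaximalIdeal_eq, coordIdeal, Ideal.span_le]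
  rintro _ ⟨i, -, rfl⟩
  refine Fin.cases ?_ (fun i => ?_) i
  · -- Modulo the other coordinates, `W` is `x₀^d`.
    refine Ideal.radical_isRadical I ⟨d, ?_⟩
    have h1 : coord 0 ^ d = polyGerm W + polyGerm (lowPoly w) := by
      rw [← map_add, hWdef, sub_add_cancel, map_pow, polyGerm_X]
    rw [h1]
    refine add_mem (Ideal.le_radical hWI) ?_
    rw [lowPoly, map_sum]
    refine sum_mem fun k _ => ?_
    rw [map_mul, polyGerm_C]
    refine Ideal.mul_mem_right _ _ (hrad ?_)
    rw [mem_germMaximalIdeal, (rep_toGerm _).self_of_nhds]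
    exact hw k
  · rw [← pullback_tailMap_coord]
    exact hrad (coord_mem_germMaximalIdeal i)

/-- The local Nullstellensatz for an isolated zero: if `0` is an isolated common zero of the `g j`,
then every germ that vanishes at `0` has a power in the ideal generated by the `g j`. -/
theorem germMaximalIdeal_le_radical {r : ℕ} (g : Fin r → HolGerm n)
    (hg : ∀ᶠ x in 𝓝 0, (∀ j, rep (g j) x = 0) → x = 0) :
    germMaximalIdeal n ≤ (Ideal.span (Set.range g)).radical := by
  induction n generalizing r with
  | zero =>
    rw [germMaximalIdeal_eq, coordIdeal, Ideal.span_le]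
    rintro _ ⟨i, -, rfl⟩
    exact i.elim0
  | succ m ih =>
    by_cases h0 : ∃ j, rep (g j) 0 ≠ 0
    · obtain ⟨j, hj⟩ := h0
      rw [Ideal.eq_top_of_isUnit_mem _ (Ideal.subset_span (Set.mem_range_self j))
        (isUnit_of_rep_ne_zero hj),
        Ideal.radical_top]
      exact le_top
    push Not at h0
    obtain ⟨j₀, hj₀⟩ : ∃ j, g j ≠ 0 := by
      by_contra! hz
      have h1 : ∀ᶠ x in 𝓝 (0 : Fin (m + 1) → ℂ), x = 0 := by
        filter_upwards [hg, rep_zero (n := m + 1)] with x hx h2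
        exact hx fun j => by rw [hz j, h2, Pi.zero_apply]
      have h2 : ∀ᶠ x in 𝓝[≠] (0 : Fin (m + 1) → ℂ), False := by
        filter_upwards [h1.filter_mono nhdsWithin_le_nhds, self_mem_nhdsWithin] with x h3 h4
        exact h4 h3
      exact h2.exists.choose_spec
    obtain ⟨L, d, hd⟩ := exists_isRegular_pullback hj₀ (h0 j₀)
    set Λ : (Fin (m + 1) → ℂ) →L[ℂ] (Fin (m + 1) → ℂ) :=
      L.toContinuousLinearMap with hΛ
    set Λ' : (Fin (m + 1) → ℂ) →L[ℂ] (Fin (m + 1) → ℂ) :=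
      L.symm.toContinuousLinearMap with hΛ'
    have hdz : d ≠ 0 := by
      rintro rfl
      refine hd.1 ?_
      rw [Finsupp.single_zero, coeff_zero_taylor, ← mem_germMaximalIdeal,
        pullback_mem_germMaximalIdeal]
      exact h0 j₀
    have hgL : ∀ᶠ x in 𝓝 (0 : Fin (m + 1) → ℂ), (∀ j, rep (pullback Λ (g j)) x = 0) → x = 0 := by
      filter_upwards [eventually_all.2 fun j => rep_pullback Λ (g j),
        (Λ.continuous.tendsto' 0 0 Λ.map_zero).eventually hg] with x h1 h2 h3
      have h4 : L x = 0 := h2 fun j => by rw [← h3 j, h1]; rfl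
      simpa using h4
    have h1 := germMaximalIdeal_le_radical_of_isRegular (fun g hg => ih g hg)
      (fun j => pullback Λ (g j)) hgL hdz hd
    have h2 (b : HolGerm (m + 1)) : pullback Λ' (pullback Λ b) = b := by
      rw [pullback_pullback]
      have : Λ.comp Λ' = ContinuousLinearMap.id ℂ _ := by
        ext1 x
        simp [hΛ, hΛ']
      rw [this, pullback_id]
    intro b hb
    obtain ⟨N, hN⟩ := h1 ((pullback_mem_germMaximalIdeal Λ).2 hb)
    refine ⟨N, ?_⟩
    rw [← h2 b, ← map_pow]
    have h3 : Ideal.span (Set.range fun j => pullback Λ (g j)) ≤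
        (Ideal.span (Set.range g)).comap (pullback Λ') := by
      refine Ideal.span_le.2 ?_
      rintro _ ⟨j, rfl⟩
      rw [SetLike.mem_coe, Ideal.mem_comap, h2]
      exact Ideal.subset_span ⟨j, rfl⟩
    exact h3 hN

lemma germMaximalIdeal_fg (n : ℕ) : (germMaximalIdeal n).FG := by
  rw [germMaximalIdeal_eq, coordIdeal]
  exact Submodule.fg_span (Set.toFinite _)

end Nullstellensatz

/-! ### Ideals of finite colength and isolated singularities -/

section FiniteColength

variable {n : ℕ} {φ f : HolGerm n} {X : Set (Fin n → ℂ)}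

lemma rep_algebraMap (c : ℂ) : rep (algebraMap ℂ (HolGerm n) c) =ᶠ[𝓝 0] fun _ => c :=
  rep_of (fun _ => c) analyticAt_const

/-- A germ that is algebraic over `ℂ` modulo an ideal and vanishes at `0` is nilpotent modulo this
ideal: a factor of its equation that does not vanish at `0` becomes a unit. -/
lemma mem_radical_of_aeval_mem {J : Ideal (HolGerm n)} {g : HolGerm n} (hg : g ∈ germMaximalIdeal n)
    {p : Polynomial ℂ} (hp : p ≠ 0) (hpg : Polynomial.aeval g p ∈ J) : g ∈ J.radical := by
  obtain ⟨q, hq, hdvd⟩ := Polynomial.exists_eq_pow_rootMultiplicity_mul_and_not_dvd p hp 0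
  rw [Polynomial.C_0, sub_zero] at hq hdvd
  refine ⟨Polynomial.rootMultiplicity 0 p, ?_⟩
  have hu : IsUnit (Polynomial.aeval g q) := by
    refine isUnit_of_rep_ne_zero fun h => hdvd (Polynomial.X_dvd_iff.2 ?_)
    have h1 : algebraMap ℂ (HolGerm n) (q.coeff 0) ∈ germMaximalIdeal n := by
      have h2 := congrArg (Polynomial.aeval g) (Polynomial.divX_mul_X_add q)
      rw [map_add, map_mul, Polynomial.aeval_X, Polynomial.aeval_C] at h2
      rw [← eq_sub_iff_add_eq'] at h2
      rw [h2]
      exact sub_mem (mem_germMaximalIdeal.2 h) (Ideal.mul_mem_left _ _ hg)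
    rwa [mem_germMaximalIdeal, (rep_algebraMap _).self_of_nhds] at h1
  rw [hq, map_mul, map_pow, Polynomial.aeval_X] at hpg
  exact (Ideal.mul_unit_mem_iff_mem J hu).1 hpg

/-- An ideal of finite colength contains a power of the maximal ideal. -/
lemma exists_germMaximalIdeal_pow_le {J : Ideal (HolGerm n)}
    (hJ : Cardinal.toENat (Module.rank ℂ (HolGerm n ⧸ J)) < ⊤) :
    ∃ N, germMaximalIdeal n ^ N ≤ J := by
  have := Module.Free.of_divisionRing ℂ (HolGerm n ⧸ J)
  have hfin : Module.Finite ℂ (HolGerm n ⧸ J) :=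
    Module.rank_lt_aleph0_iff.1 (Cardinal.toENat_lt_top.1 hJ)
  refine Ideal.exists_pow_le_of_le_radical_of_fg (fun g hg => ?_) (germMaximalIdeal_fg n)
  obtain ⟨p, hp, hpg⟩ := IsIntegral.of_finite ℂ (Ideal.Quotient.mkₐ ℂ J g)
  rw [← Polynomial.aeval_def, Polynomial.aeval_algHom_apply, Ideal.Quotient.mkₐ_eq_mk,
    Ideal.Quotient.eq_zero_iff_mem] at hpg
  exact mem_radical_of_aeval_mem hg hp.ne_zero hpg

/-- The Tjurina ideal of an isolated hypersurface singularity contains a power of the maximal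
ideal. -/
lemma IsIHS.exists_pow_le_jacobianIdeal_sup (hX : IsIHS φ X) :
    ∃ N, germMaximalIdeal n ^ N ≤ jacobianIdeal φ ⊔ Ideal.span {φ} := by
  refine Ideal.exists_pow_le_of_le_radical_of_fg ?_ (germMaximalIdeal_fg n)
  refine (germMaximalIdeal_le_radical (Fin.cons φ fun i => pd i φ : Fin (n + 1) → HolGerm n)
    ?_).trans (Ideal.radical_mono (Ideal.span_le.2 ?_))
  · filter_upwards [hX.zeroSet, hX.isolated] with x h1 h2 h3
    by_contra hx
    obtain ⟨i, hi⟩ := h2 (h1.2 (h3 0)) hx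
    exact hi (h3 i.succ)
  · rintro _ ⟨j, rfl⟩
    refine Fin.cases ?_ (fun i => ?_) j
    · exact Ideal.mem_sup_right (Ideal.mem_span_singleton_self φ)
    · exact Ideal.mem_sup_left (Ideal.subset_span ⟨i, rfl⟩)

lemma IsIHS.exists_pow_le_diffImage_sup (hX : IsIHS φ X) (hf : relBruceRobertsNumber f X < ⊤) :
    ∃ N, germMaximalIdeal n ^ N ≤ diffImage f (trivialVectorFields φ) ⊔ Ideal.span {φ} := by
  obtain ⟨M, hM⟩ := hX.exists_pow_le_jacobianIdeal_sup
  obtain ⟨N, hN⟩ := exists_germMaximalIdeal_pow_le hf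
  refine ⟨M + N, ?_⟩
  rw [pow_add]
  exact (Ideal.mul_mono hM hN).trans (jacobianIdeal_sup_mul_relDiffImage_le f hX)

end FiniteColength

section OneVariable

/-- The zeros of a nonzero germ in one variable are isolated. -/
lemma eventually_eq_zero_of_rep_eq_zero {φ : HolGerm 1} (hφ : φ ≠ 0) :
    ∀ᶠ x in 𝓝 (0 : Fin 1 → ℂ), rep φ x = 0 → x = 0 := by
  by_cases h0 : rep φ 0 = 0
  · obtain ⟨v, hv⟩ := exists_not_eventually_smul hφ
    have hv0 : v 0 ≠ 0 := fun h => hv <| by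
      have : v = 0 := by
        ext i
        rw [Subsingleton.elim i 0, h, Pi.zero_apply]
      simp [this, h0]
    have hana : AnalyticAt ℂ (fun t : ℂ => rep φ (t • v)) 0 :=
      AnalyticAt.fun_comp (by simpa using analyticAt_rep φ)
        ((ContinuousLinearMap.toSpanSingleton ℂ v).analyticAt 0)
    have h1 := eventually_nhdsWithin_iff.1
      (hana.eventually_eq_zero_or_eventually_ne_zero.resolve_left hv)
    have h2 : Tendsto (fun x : Fin 1 → ℂ => x 0 / v 0) (𝓝 0) (𝓝 0) :=
      Continuous.tendsto' (by fun_prop) _ _ (by simp)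
    filter_upwards [h2.eventually h1] with x hx h3
    have h4 : (x 0 / v 0) • v = x := by
      ext i
      rw [Subsingleton.elim i 0, Pi.smul_apply, smul_eq_mul, div_mul_cancel₀ _ hv0]
    rw [h4] at hx
    by_contra hne
    refine hx (fun h => hne ?_) h3
    rw [← h4, h, zero_smul]
  · filter_upwards [(analyticAt_rep φ).continuousAt.eventually_ne h0] with x hx h
    exact absurd h hx

lemma pd_coord {n : ℕ} (i : Fin n) : pd i (coord i) = 1 := by
  rw [coord, pd_of]
  refine of_eq_of _ analyticAt_const (Eventually.of_forall fun x => ?_)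
  have : HasFDerivAt (fun x : Fin n → ℂ => x i)
      (ContinuousLinearMap.proj (R := ℂ) (φ := fun _ : Fin n => ℂ) i) x :=
    (ContinuousLinearMap.proj (R := ℂ) (φ := fun _ : Fin n => ℂ) i).hasFDerivAt
  simp [this.fderiv]

/-- In one variable `X = {0}`, so that a reduced equation of `X` has a zero of order one. -/
lemma IsIHS.isUnit_pd {φ : HolGerm 1} {X : Set (Fin 1 → ℂ)} (hX : IsIHS φ X) :
    IsUnit (pd 0 φ) := by
  have h1 : coord 0 ∈ vanishingIdeal X := by
    change ∀ᶠ x in 𝓝 (0 : Fin 1 → ℂ), x ∈ X → rep (coord 0) x = 0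
    filter_upwards [eventually_eq_zero_of_rep_eq_zero hX.ne_zero, hX.zeroSet,
      rep_of (fun x : Fin 1 → ℂ => x 0) (analyticAt_coord 0 0)] with x h1 h2 h3 h4
    rw [coord, h3, h1 (h2.1 h4), Pi.zero_apply]
  rw [hX.vanishingIdeal_eq, Ideal.mem_span_singleton'] at h1
  obtain ⟨a, ha⟩ := h1
  refine isUnit_of_rep_ne_zero fun h => ?_
  have h2 := pd_coord (0 : Fin 1)
  rw [← ha, pd_mul] at h2
  have h3 : (1 : HolGerm 1) ∈ germMaximalIdeal 1 :=
    h2 ▸ add_mem (Ideal.mul_mem_left _ _ h) (Ideal.mul_mem_right _ _ hX.map_zero)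
  rw [mem_germMaximalIdeal, rep_one.self_of_nhds] at h3
  exact one_ne_zero h3

end OneVariable

/-- Up to multiples of `φ`, a field in `Θ_X` that `df` maps into `I_X` is a trivial field in the
kernel of `df`. -/
theorem IsIHS.exists_eq_add_smul {n : ℕ} {φ f : HolGerm n} {X : Set (Fin n → ℂ)} (hX : IsIHS φ X)
    (hf : relBruceRobertsNumber f X < ⊤) {ξ : VectorField n} (h1 : diff φ ξ ∈ Ideal.span {φ})
    (h2 : diff f ξ ∈ Ideal.span {φ}) :
    ∃ τ ∈ trivialVectorFields φ, diff f τ = 0 ∧ ∃ η, ξ = τ + φ • η := by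
  match n with
  | 0 =>
    refine absurd (ext_of_rep (Eventually.of_forall fun x => ?_)) hX.ne_zero
    rw [Subsingleton.elim x 0, hX.map_zero, rep_zero.self_of_nhds, Pi.zero_apply]
  | 1 =>
    refine ⟨0, zero_mem _, (diff f).map_zero, ?_⟩
    rw [diff_apply, Fin.sum_univ_one, Ideal.mul_unit_mem_iff_mem _ hX.isUnit_pd,
      Ideal.mem_span_singleton'] at h1
    obtain ⟨a, ha⟩ := h1
    refine ⟨fun _ => a, ?_⟩
    ext i : 1
    rw [Subsingleton.elim i 0, ← ha, zero_add, Pi.smul_apply, smul_eq_mul, mul_comm]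
  | n + 2 =>
    obtain ⟨N, hN⟩ := hX.exists_pow_le_diffImage_sup hf
    exact exists_eq_add_smul_of_diff_mem (by omega) _
      (depthGE_quotient_span_singleton (by omega) hX.ne_zero) hN h1 h2

end BruceRoberts

end

theorem mainTheorem2 {n : ℕ} (φ f : HolGerm n) (X : Set (Fin n → ℂ)) (hX : IsIHS φ X)
    (hf : relBruceRobertsNumber f X < ⊤) :
    -- (i)
    Nonempty
      ((logVectorFields X ⧸ (trivialVectorFields φ).submoduleOf (logVectorFields X))
        ≃ₗ[HolGerm n]
        (↥(diffImage f (logVectorFields X) ⊔ vanishingIdeal X) ⧸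
          (diffImage f (trivialVectorFields φ) ⊔ vanishingIdeal X).submoduleOf
            (diffImage f (logVectorFields X) ⊔ vanishingIdeal X))) ∧
    -- (ii)
    Nonempty
      ((logVectorFields X ⧸ (trivialVectorFields φ).submoduleOf (logVectorFields X))
        ≃ₗ[HolGerm n]
        (↥(diffImage f (logVectorFields X)) ⧸
          (diffImage f (trivialVectorFields φ)).submoduleOf (diffImage f (logVectorFields X)))) ∧
    -- (iii)
    diffImage f (logVectorFields X) ⊓ vanishingIdeal X = jacobianIdeal f * vanishingIdeal X ∧
    -- (iv)
    Nonempty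
      ((HolGerm n ⧸ jacobianIdeal f)
        ≃ₗ[HolGerm n]
        (↥(relDiffImage f X) ⧸
          (diffImage f (logVectorFields X)).submoduleOf (relDiffImage f X))) ∧
    -- (v)
    (diffImage f (logVectorFields X)).colon (vanishingIdeal X : Set (HolGerm n)) =
      jacobianIdeal f ∧
    -- (vi)
    (diffImage f (trivialVectorFields φ)).colon (vanishingIdeal X : Set (HolGerm n)) =
      jacobianIdeal f := by
  exact isomorphisms_and_colon_eq hX
    (fun _ ha => (mul_eq_zero_of_germ ha).resolve_right hX.ne_zero)
    (fun _ h1 h2 => hX.exists_eq_add_smul hf h1 h2)
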